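/- Let $\mathbb K$ be a field of characteristic zero and let $(V,\cdot,\delta_V)$ be a (not necessarily unitary) bialgebra over $\mathbb K$: an associative, not necessarily unitary or commutative, algebra with a coassociative coproduct $\delta_V:V\to V\otimes V$ with counit $\epsilon_V$, both multiplicative. Write $\delta_V(v)=v'\otimes v''$. Let $uV=\mathbb K\oplus V$ be its unitary extension, the unitary bialgebra with $(\lambda+v)(\mu+w)=\lambda\mu+\lambda w+\mu v+v\cdot w$, $\delta_{uV}(\lambda+v)=\lambda\,1\otimes 1+\delta_V(v)$ and $\epsilon_{uV}(\lambda+v)=\lambda+\epsilon_V(v)$. *The structures on words.* On the tensor algebra $T(V)$ let ⧢ be the quasishuffle product, given for $x,y\in V$ and words $v,w$ by $1$ ⧢ $w=w$, $v$ ⧢ $1=v$, and $xv$ ⧢ $yw=x(v$ ⧢ $yw)+y(xv$ ⧢ $w)+(x\cdot y)(v$ ⧢ $w)$. Let $\Delta(v_1\ldots v_n)=\sum_{k=0}^n v_1\ldots v_k\otimes v_{k+1}\ldots v_n$ be deconcatenation, whose counit $\varepsilon_\Delta$ vanishes on words of length $\ge 1$ and satisfies $\varepsilon_\Delta(1)=1$.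 Let $\delta(1)=1\otimes 1$ and, for $n\ge 1$, $$\delta(v_1\ldots v_n)=\sum_{1\le i_1<\cdots<i_p<n}\Bigl(\prod_{1\le i\le i_1}^{\cdot}v_i'\Bigr)\ldots\Bigl(\prod_{i_p+1\le i\le n}^{\cdot}v_i'\Bigr)\otimes (v_1''\ldots v_{i_1}'')\text{ ⧢ }\ldots\text{ ⧢ }(v_{i_p+1}''\ldots v_n''),$$ the sum being over all $p\ge 0$ and the products $\prod^\cdot$ being taken in $V$ in increasing order of the indices. Its counit is $\epsilon_\delta(1)=1$, $\epsilon_\delta(v)=\epsilon_V(v)$ for $v\in V$, and $\epsilon_\delta=0$ on words of length $\ge 2$. Finally let $\rho:T(V)\to T(V)\otimes uV$ be the linear map with $\rho(1)=1\otimes 1$ and $$\rho(v_1\ldots v_n)=v_1'\ldots v_n'\otimes v_1''\cdot\ldots\cdot v_n''\in T(V)\otimes V\qquad (n\ge 1).$$ *Definitions.* A bialgebra over a unitary bialgebra $W$ is a bialgebra $(B,m,\Delta)$ with a right coaction $\rho:B\to B\otimes W$ such that the unit, the product, the counit and the coproduct of $B$ are morphisms of $W$-comodules, that is $\rho(1_B)=1_B\otimes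 1_W$, $\rho\circ m=(m\otimes m_W)\circ(\mathrm{Id}\otimes c\otimes\mathrm{Id})\circ(\rho\otimes\rho)$, $(\varepsilon_\Delta\otimes\mathrm{Id})\circ\rho(x)=\varepsilon_\Delta(x)1_W$ for all $x\in B$, and $(\Delta\otimes\mathrm{Id})\circ\rho=m_{1,3,24}\circ(\rho\otimes\rho)\circ\Delta$, where $c$ is the flip and $m_{1,3,24}(b_1\otimes w_2\otimes b_3\otimes w_4)=b_1\otimes b_3\otimes w_2w_4$. A bialgebra over the nonunitary bialgebra $V$ is a bialgebra over $uV$ such that $\rho(\ker\varepsilon_\Delta)\subseteq B\otimes V$. A double bialgebra $(B,m,\Delta,\delta)$ consists of two bialgebras $(B,m,\Delta)$, $(B,m,\delta)$ with the same product such that $(B,m,\Delta)$ with the coaction $\delta$ is a bialgebra over $(B,m,\delta)$. A double bialgebra over $V$ is a double bialgebra $(B,m,\Delta,\delta)$ with a map $\rho$ such that $(B,m,\Delta,\rho)$ is a bialgebra over $V$ and $(\mathrm{Id}\otimes c)\circ(\rho\otimes\mathrm{Id})\circ\delta=(\delta\otimes\mathrm{Id})\circ\rho$. **Proposition.** The map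 $\rho$ is a right coaction of $uV$ on $T(V)$. Moreover: 1. $(T(V),\text{⧢},\Delta,\rho)$ is a bialgebra over $V$ if and only if $(V,\cdot)$ is commutative. 2. $(T(V),\text{⧢},\Delta,\delta,\rho)$ is a double bialgebra over $V$ if and only if $(V,\cdot,\delta_V)$ is commutative and cocommutative. -/

import Mathlib

open scoped TensorProduct

noncomputable section

universe u v w

namespace QuasiShuffle

/-! ### Bialgebras given by their structure maps -/

/-- The structure maps of a (candidate) bialgebra on a `K`-module `B`: product, unit, coproduct,
counit. The laws are stated in `BialgOps.IsBialgebra`. -/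
structure BialgOps (K : Type u) (B : Type v) [Field K] [AddCommGroup B] [Module K B] where
  mul : B ⊗[K] B →ₗ[K] B
  one : B
  comul : B →ₗ[K] B ⊗[K] B
  counit : B →ₗ[K] K

/-- The structure maps of a bialgebra in the sense of Mathlib. -/
def BialgOps.ofBialgebra (K : Type u) (W : Type w) [Field K] [Ring W] [Bialgebra K W] :
    BialgOps K W where
  mul := LinearMap.mul' K W
  one := 1
  comul := Coalgebra.comul
  counit := Coalgebra.counit

section Predicates

variable {K : Type u} {B : Type v} {W : Type w} [Field K]
  [AddCommGroup B] [Module K B] [AddCommGroup W] [Module K W]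

/-- `(B, m, 1, Δ, ε)` is a (unital, associative, counital, coassociative) bialgebra. -/
structure BialgOps.IsBialgebra (S : BialgOps K B) : Prop where
  mul_assoc : ∀ x y z : B, S.mul (S.mul (x ⊗ₜ y) ⊗ₜ z) = S.mul (x ⊗ₜ S.mul (y ⊗ₜ z))
  one_mul : ∀ x : B, S.mul (S.one ⊗ₜ x) = x
  mul_one : ∀ x : B, S.mul (x ⊗ₜ S.one) = x
  coassoc : (TensorProduct.assoc K B B B).toLinearMap ∘ₗ S.comul.rTensor B ∘ₗ S.comul =
    S.comul.lTensor B ∘ₗ S.comul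
  counit_left : ∀ x : B, S.counit.rTensor B (S.comul x) = 1 ⊗ₜ x
  counit_right : ∀ x : B, S.counit.lTensor B (S.comul x) = x ⊗ₜ 1
  comul_one : S.comul S.one = S.one ⊗ₜ S.one
  counit_one : S.counit S.one = 1
  /-- `Δ ∘ m = (m ⊗ m) ∘ (id ⊗ c ⊗ id) ∘ (Δ ⊗ Δ)`. -/
  comul_mul : S.comul ∘ₗ S.mul =
    TensorProduct.map S.mul S.mul ∘ₗ
      (TensorProduct.tensorTensorTensorComm K B B B B).toLinearMap ∘ₗ
        TensorProduct.map S.comul S.comul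
  counit_mul : ∀ x y : B, S.counit (S.mul (x ⊗ₜ y)) = S.counit x * S.counit y

/-- `ρ : B → B ⊗ W` is a right coaction of the coalgebra underlying `T` on `B`:
`(ρ ⊗ id) ∘ ρ = (id ⊗ δ) ∘ ρ` and `(id ⊗ ε) ∘ ρ = id`. -/
structure IsRightCoaction (T : BialgOps K W) (ρ : B →ₗ[K] B ⊗[K] W) : Prop where
  coassoc : (TensorProduct.assoc K B W W).toLinearMap ∘ₗ ρ.rTensor W ∘ₗ ρ =
    T.comul.lTensor B ∘ₗ ρ
  counit : ∀ x : B, T.counit.lTensor B (ρ x) = x ⊗ₜ 1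

/-- The map `m_{1,3,24} : B ⊗ W ⊗ B ⊗ W → B ⊗ B ⊗ W`,
`b₁ ⊗ w₂ ⊗ b₃ ⊗ w₄ ↦ b₁ ⊗ b₃ ⊗ w₂ w₄`. -/
def mul13_24 (B : Type v) [AddCommGroup B] [Module K B] (T : BialgOps K W) :
    (B ⊗[K] W) ⊗[K] (B ⊗[K] W) →ₗ[K] (B ⊗[K] B) ⊗[K] W :=
  T.mul.lTensor (B ⊗[K] B) ∘ₗ (TensorProduct.tensorTensorTensorComm K B W B W).toLinearMap

/-- `(B, m, Δ, ρ)` is a bialgebra over `W`, i.e. a bialgebra in the category of right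
`W`-comodules. -/
structure IsBialgebraOver (T : BialgOps K W) (S : BialgOps K B) (ρ : B →ₗ[K] B ⊗[K] W) :
    Prop where
  isBialgebra : S.IsBialgebra
  isRightCoaction : IsRightCoaction T ρ
  one_colinear : ρ S.one = S.one ⊗ₜ T.one
  mul_colinear : ρ ∘ₗ S.mul =
    TensorProduct.map S.mul T.mul ∘ₗ
      (TensorProduct.tensorTensorTensorComm K B W B W).toLinearMap ∘ₗ TensorProduct.map ρ ρ
  counit_colinear : ∀ x : B,
    TensorProduct.lid K W (S.counit.rTensor W (ρ x)) = S.counit x • T.one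
  comul_colinear : S.comul.rTensor W ∘ₗ ρ = mul13_24 B T ∘ₗ TensorProduct.map ρ ρ ∘ₗ S.comul

/-- `(B, m, Δ, δ)` is a double bialgebra: `(B, m, δ)` is a bialgebra, and `(B, m, Δ)` is a
bialgebra in the category of right `(B, m, δ)`-comodules for the coaction `δ`. Here `εδ` is the
counit of `δ`. -/
structure IsDoubleBialgebra (S : BialgOps K B) (δ : B →ₗ[K] B ⊗[K] B) (εδ : B →ₗ[K] K) :
    Prop where
  isBialgebra : BialgOps.IsBialgebra (K := K) ⟨S.mul, S.one, δ, εδ⟩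
  isBialgebraOver : IsBialgebraOver (K := K) ⟨S.mul, S.one, δ, εδ⟩ S δ

/-- `(B, m, Δ, δ, ρ)` is a double bialgebra over `W`. The last condition is
`(id ⊗ c) ∘ (ρ ⊗ id) ∘ δ = (δ ⊗ id) ∘ ρ`, where `c` is the flip, as maps `B → (B ⊗ B) ⊗ W`
(`rightComm` is `(b ⊗ w) ⊗ b' ↦ (b ⊗ b') ⊗ w`). -/
structure IsDoubleBialgebraOver (T : BialgOps K W) (S : BialgOps K B)
    (δ : B →ₗ[K] B ⊗[K] B) (εδ : B →ₗ[K] K) (ρ : B →ₗ[K] B ⊗[K] W) : Prop where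
  isDoubleBialgebra : IsDoubleBialgebra S δ εδ
  isBialgebraOver : IsBialgebraOver T S ρ
  compat : (TensorProduct.rightComm K B W B).toLinearMap ∘ₗ ρ.rTensor B ∘ₗ δ = δ.rTensor W ∘ₗ ρ

end Predicates

/-! ### Nonunitary bialgebras and their unitary extension -/

/-- A (not necessarily unitary) bialgebra: a nonunital associative algebra `V` which is also a
counital coassociative coalgebra, whose coproduct and counit are multiplicative. -/
class NonunitalBialgebra (K : Type u) (V : Type v) [Field K] [NonUnitalRing V] [Module K V]
    [IsScalarTower K V V] [SMulCommClass K V V] extends Coalgebra K V where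
  comul_mul : ∀ a b : V, comul (a * b) = comul a * comul b
  counit_mul : ∀ a b : V, counit (a * b) = counit a * counit b

section UnitaryExtension

variable (K : Type u) (V : Type v) [Field K] [NonUnitalRing V] [Module K V]

/-- The inclusion `V → uV = K ⊕ V`. -/
abbrev incl : V →ₗ[K] Unitization K V := Unitization.inrHom K K V

/-- The projection `uV = K ⊕ V → V`. -/
abbrev proj : Unitization K V →ₗ[K] V := Unitization.sndHom K K V

variable {K V} in
theorem unitization_inl (r : K) : (Unitization.inl r : Unitization K V) = r • 1 := by
  ext <;> simp

variable {K V} in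
theorem unitization_linear_ext {M : Type w} [AddCommMonoid M] [Module K M]
    {f g : Unitization K V →ₗ[K] M} (h1 : f 1 = g 1)
    (h2 : ∀ a : V, f (Unitization.inr a) = g (Unitization.inr a)) : f = g := by
  refine LinearMap.ext fun x => ?_
  induction x using Unitization.ind with
  | inl_add_inr r a =>
    rw [map_add, map_add, unitization_inl, map_smul, map_smul, h1, h2]

variable [IsScalarTower K V V] [SMulCommClass K V V]

/-- The coproduct of `uV`: `λ + v ↦ λ 1 ⊗ 1 + δ_V(v)`. -/
def uComul [Coalgebra K V] : Unitization K V →ₗ[K] Unitization K V ⊗[K] Unitization K V :=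
  (Unitization.fstHom K V).toLinearMap.smulRight (1 ⊗ₜ 1) +
    TensorProduct.map (incl K V) (incl K V) ∘ₗ Coalgebra.comul ∘ₗ proj K V

/-- The counit of `uV`: `λ + v ↦ λ + ε_V(v)`. -/
def uCounit [Coalgebra K V] : Unitization K V →ₗ[K] K :=
  (Unitization.fstHom K V).toLinearMap + Coalgebra.counit ∘ₗ proj K V

variable {K V}

theorem map_incl_mul (x y : V ⊗[K] V) :
    TensorProduct.map (incl K V) (incl K V) (x * y) =
      TensorProduct.map (incl K V) (incl K V) x * TensorProduct.map (incl K V) (incl K V) y := by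
  induction x using TensorProduct.induction_on with
  | zero => simp
  | add x x' hx hx' => simp only [add_mul, map_add, hx, hx']
  | tmul a b =>
    induction y using TensorProduct.induction_on with
    | zero => simp
    | add y y' hy hy' => simp only [mul_add, map_add, hy, hy']
    | tmul c d => simp

variable [NonunitalBialgebra K V]

theorem uComul_one : uComul K V 1 = 1 ⊗ₜ 1 := by
  simp [uComul]

theorem uComul_inr (a : V) : uComul K V (Unitization.inr a) =
    TensorProduct.map (incl K V) (incl K V) (Coalgebra.comul a) := by
  simp [uComul]

theorem uCounit_one : uCounit K V 1 = 1 := by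
  simp [uCounit]

theorem uCounit_inr (a : V) : uCounit K V (Unitization.inr a) = Coalgebra.counit a := by
  simp [uCounit]

instance : Coalgebra K (Unitization K V) where
  comul := uComul K V
  counit := uCounit K V
  coassoc := by
    apply unitization_linear_ext
    · simp only [LinearMap.comp_apply, LinearEquiv.coe_coe, uComul_one, LinearMap.rTensor_tmul,
        LinearMap.lTensor_tmul, TensorProduct.assoc_tmul]
    · intro a
      have key : (TensorProduct.assoc K _ _ _).toLinearMap ∘ₗ
          (uComul K V).rTensor _ ∘ₗ TensorProduct.map (incl K V) (incl K V) =
          TensorProduct.map (incl K V) (TensorProduct.map (incl K V) (incl K V)) ∘ₗ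
            (TensorProduct.assoc K V V V).toLinearMap ∘ₗ
              (Coalgebra.comul (R := K) (A := V)).rTensor V := by
        refine TensorProduct.ext' fun b c => ?_
        simp only [LinearMap.comp_apply, TensorProduct.map_tmul, LinearMap.rTensor_tmul,
          Unitization.inrHom_apply, uComul_inr]
        have key2 : ∀ y : V ⊗[K] V, (TensorProduct.assoc K _ _ _)
            (TensorProduct.map (incl K V) (incl K V) y ⊗ₜ[K] (Unitization.inr c)) =
            TensorProduct.map (incl K V) (TensorProduct.map (incl K V) (incl K V))
              (TensorProduct.assoc K V V V (y ⊗ₜ[K] c)) := by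
          intro y
          exact LinearMap.congr_fun (TensorProduct.map_map_comp_assoc_eq (incl K V) (incl K V)
            (incl K V)).symm (y ⊗ₜ[K] c)
        exact key2 _
      have key' : (uComul K V).lTensor _ ∘ₗ TensorProduct.map (incl K V) (incl K V) =
          TensorProduct.map (incl K V) (TensorProduct.map (incl K V) (incl K V)) ∘ₗ
            (Coalgebra.comul (R := K) (A := V)).lTensor V := by
        refine TensorProduct.ext' fun b c => ?_
        simp only [LinearMap.comp_apply, TensorProduct.map_tmul, LinearMap.lTensor_tmul,
          Unitization.inrHom_apply, uComul_inr]
      have h1 := LinearMap.congr_fun key (Coalgebra.comul a)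
      have h2 := LinearMap.congr_fun key' (Coalgebra.comul a)
      simp only [LinearMap.comp_apply, LinearEquiv.coe_coe, Coalgebra.coassoc_apply] at h1 h2
      simp only [LinearMap.comp_apply, LinearEquiv.coe_coe, uComul_inr]
      rw [h1, h2]
  rTensor_counit_comp_comul := by
    apply unitization_linear_ext
    · simp [uComul_one, uCounit_one]
    · intro a
      have key : (uCounit K V).rTensor _ ∘ₗ TensorProduct.map (incl K V) (incl K V) =
          (incl K V).lTensor K ∘ₗ (Coalgebra.counit (R := K) (A := V)).rTensor V :=
        TensorProduct.ext' fun b c => by simp [uCounit_inr]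
      have h := LinearMap.congr_fun key (Coalgebra.comul a)
      rw [LinearMap.comp_apply, LinearMap.comp_apply, Coalgebra.rTensor_counit_comul] at h
      simp only [LinearMap.comp_apply, uComul_inr]
      rw [h]
      simp
  lTensor_counit_comp_comul := by
    apply unitization_linear_ext
    · simp [uComul_one, uCounit_one]
    · intro a
      have key : (uCounit K V).lTensor _ ∘ₗ TensorProduct.map (incl K V) (incl K V) =
          (incl K V).rTensor K ∘ₗ (Coalgebra.counit (R := K) (A := V)).lTensor V :=
        TensorProduct.ext' fun b c => by simp [uCounit_inr]
      have h := LinearMap.congr_fun key (Coalgebra.comul a)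
      rw [LinearMap.comp_apply, LinearMap.comp_apply, Coalgebra.lTensor_counit_comul] at h
      simp only [LinearMap.comp_apply, uComul_inr]
      rw [h]
      simp

theorem uCounit_mul (x y : Unitization K V) :
    uCounit K V (x * y) = uCounit K V x * uCounit K V y := by
  induction x using Unitization.ind with
  | inl_add_inr r a =>
  induction y using Unitization.ind with
  | inl_add_inr s b =>
    simp only [unitization_inl, add_mul, mul_add, smul_mul_assoc, mul_smul_comm, one_mul, mul_one,
      ← Unitization.inr_mul, map_add, map_smul, uCounit_one, uCounit_inr,
      NonunitalBialgebra.counit_mul]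

theorem uComul_mul (x y : Unitization K V) :
    uComul K V (x * y) = uComul K V x * uComul K V y := by
  induction x using Unitization.ind with
  | inl_add_inr r a =>
  induction y using Unitization.ind with
  | inl_add_inr s b =>
    simp only [unitization_inl, add_mul, mul_add, smul_mul_assoc, mul_smul_comm, one_mul, mul_one,
      ← Unitization.inr_mul, map_add, map_smul, uComul_one, uComul_inr,
      NonunitalBialgebra.comul_mul, map_incl_mul, ← Algebra.TensorProduct.one_def]

/-- The unitary extension `uV` is a bialgebra. -/
instance : Bialgebra K (Unitization K V) :=
  Bialgebra.mk' K (Unitization K V) uCounit_one (uCounit_mul _ _) uComul_one (uComul_mul _ _)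

end UnitaryExtension

section Nonunitary

variable {K : Type u} {B : Type v} [Field K] [AddCommGroup B] [Module K B]

/-- `(B, m, Δ, ρ)` is a bialgebra over the nonunitary bialgebra `V`: it is a bialgebra over `uV`
such that `ρ (ker ε_Δ) ⊆ B ⊗ V`. -/
structure IsBialgebraOverNonunital (V : Type w) [NonUnitalRing V] [Module K V]
    [IsScalarTower K V V] [SMulCommClass K V V] [NonunitalBialgebra K V]
    (S : BialgOps K B) (ρ : B →ₗ[K] B ⊗[K] Unitization K V) : Prop where
  isBialgebraOver : IsBialgebraOver (BialgOps.ofBialgebra K (Unitization K V)) S ρ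
  map_ker_le : (LinearMap.ker S.counit).map ρ ≤ LinearMap.range ((incl K V).lTensor B)

/-- `(B, m, Δ, δ, ρ)` is a double bialgebra over the nonunitary bialgebra `V`: it is a double
bialgebra over `uV` such that `(B, m, Δ, ρ)` is a bialgebra over `V`. -/
structure IsDoubleBialgebraOverNonunital (V : Type w) [NonUnitalRing V] [Module K V]
    [IsScalarTower K V V] [SMulCommClass K V V] [NonunitalBialgebra K V]
    (S : BialgOps K B) (δ : B →ₗ[K] B ⊗[K] B) (εδ : B →ₗ[K] K)
    (ρ : B →ₗ[K] B ⊗[K] Unitization K V) : Prop where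
  isDoubleBialgebraOver :
    IsDoubleBialgebraOver (BialgOps.ofBialgebra K (Unitization K V)) S δ εδ ρ
  isBialgebraOverNonunital : IsBialgebraOverNonunital V S ρ

end Nonunitary

/-! ### Words and linear maps on the tensor algebra -/

section Words

theorem ofFn_update {V : Type v} {n : ℕ} [DecidableEq (Fin n)] (v : Fin n → V) (i : Fin n) (x : V) :
    List.ofFn (Function.update v i x) =
      (List.ofFn v).take i ++ x :: (List.ofFn v).drop (i + 1) := by
  have h : List.ofFn (Function.update v i x) = (List.ofFn v).set i x := by
    apply List.ext_getElem
    · simp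
    · intro j h1 h2
      simp only [List.getElem_ofFn, List.getElem_set, Function.update_apply, Fin.ext_iff,
        eq_comm]
  rw [h, List.set_eq_take_append_cons_drop, if_pos (by simp)]

variable (K : Type u) {V : Type v} {M : Type w} [Field K] [AddCommGroup V] [Module K V]
  [AddCommGroup M] [Module K M]

/-- The word `v₁ ... vₙ ∈ T(V)`. -/
def word (l : List V) : TensorAlgebra K V := (l.map (TensorAlgebra.ι K)).prod

@[simp] theorem word_nil : word K ([] : List V) = 1 := rfl

@[simp] theorem word_cons (a : V) (l : List V) :
    word K (a :: l) = TensorAlgebra.ι K a * word K l := by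
  simp [word]

@[simp] theorem word_append (l l' : List V) : word K (l ++ l') = word K l * word K l' := by
  simp [word]

/-- A function of words is multilinear in the letters. -/
def SlotLinear (F : List V → M) : Prop :=
  ∀ l₁ l₂ : List V, IsLinearMap K fun a : V => F (l₁ ++ a :: l₂)

variable {K}

/-- The restriction of a multilinear function of words to words of length `n`. -/
def SlotLinear.toMultilinearMap {F : List V → M} (h : SlotLinear K F) (n : ℕ) :
    MultilinearMap K (fun _ : Fin n => V) M where
  toFun v := F (List.ofFn v)
  map_update_add' v i x y := by
    simp only [ofFn_update]
    exact (h _ _).map_add x y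
  map_update_smul' v i c x := by
    simp only [ofFn_update]
    exact (h _ _).map_smul c x

/-- The linear map on `T(V)` with prescribed values on words. -/
def SlotLinear.extend {F : List V → M} (h : SlotLinear K F) : TensorAlgebra K V →ₗ[K] M :=
  DirectSum.toModule K ℕ M (fun n => PiTensorProduct.lift (h.toMultilinearMap n)) ∘ₗ
    (TensorAlgebra.equivDirectSum (R := K) (M := V)).toLinearMap

@[simp] theorem SlotLinear.extend_word {F : List V → M} (h : SlotLinear K F) (l : List V) :
    h.extend (word K l) = F l := by
  have h1 : word K l = TensorAlgebra.tprod K V l.length l.get := by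
    rw [TensorAlgebra.tprod_apply, word]
    congr 1
    conv_lhs => rw [← List.ofFn_get l, List.map_ofFn]
    rfl
  rw [h1, SlotLinear.extend, LinearMap.comp_apply]
  change DirectSum.toModule K ℕ M _ (TensorAlgebra.toDirectSum _) = _
  rw [TensorAlgebra.toDirectSum_tensorPower_tprod, ← DirectSum.lof_eq_of K, DirectSum.toModule_lof,
    PiTensorProduct.lift.tprod]
  change F (List.ofFn l.get) = F l
  rw [List.ofFn_get]

/-- Linear maps on `T(V)` that agree on words are equal. -/
theorem linearMap_ext_word {f g : TensorAlgebra K V →ₗ[K] M}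
    (h : ∀ l : List V, f (word K l) = g (word K l)) : f = g := by
  have : f ∘ₗ (TensorAlgebra.equivDirectSum (R := K) (M := V)).symm.toLinearMap =
      g ∘ₗ (TensorAlgebra.equivDirectSum (R := K) (M := V)).symm.toLinearMap := by
    refine DirectSum.linearMap_ext K fun n => PiTensorProduct.ext (MultilinearMap.ext fun v => ?_)
    have h2 : (TensorAlgebra.equivDirectSum (R := K) (M := V)).symm
        (DirectSum.lof K ℕ (fun n => ⨂[K]^n V) n (PiTensorProduct.tprod K v)) =
        word K (List.ofFn v) := by
      have h3 : word K (List.ofFn v) = TensorAlgebra.tprod K V n v := by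
        rw [TensorAlgebra.tprod_apply, word, List.map_ofFn]
        rfl
      rw [AlgEquiv.symm_apply_eq, h3]
      change _ = TensorAlgebra.toDirectSum _
      rw [TensorAlgebra.toDirectSum_tensorPower_tprod, DirectSum.lof_eq_of]
    simp only [LinearMap.compMultilinearMap_apply, LinearMap.comp_apply]
    change f ((TensorAlgebra.equivDirectSum (R := K) (M := V)).symm _) =
      g ((TensorAlgebra.equivDirectSum (R := K) (M := V)).symm _)
    rw [h2, h]
  ext x
  have h3 := LinearMap.congr_fun this (TensorAlgebra.equivDirectSum x)
  simpa using h3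

theorem slotLinear_word : SlotLinear K (word K : List V → TensorAlgebra K V) := fun l₁ l₂ =>
  ⟨fun a b => by simp [mul_add, add_mul], fun c a => by simp⟩

end Words

/-! ### The quasishuffle algebra and its coproducts -/

section QSh

variable (K : Type u) {V : Type v} [Field K] [NonUnitalRing V] [Module K V]

/-- The quasishuffle product of two words:
`1 ⧢ w = w`, `v ⧢ 1 = v`, `xv ⧢ yw = x (v ⧢ yw) + y (xv ⧢ w) + (x·y) (v ⧢ w)`. -/
def qshWord : List V → List V → TensorAlgebra K V
  | [], l => word K l
  | a :: k, [] => word K (a :: k)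
  | a :: k, b :: l =>
    TensorAlgebra.ι K a * qshWord k (b :: l) + TensorAlgebra.ι K b * qshWord (a :: k) l +
      TensorAlgebra.ι K (a * b) * qshWord k l
termination_by k l => k.length + l.length

/-- Deconcatenation of a word: `∑_{i=0}^n v₁...vᵢ ⊗ vᵢ₊₁...vₙ`. -/
def deconcWord (l : List V) : TensorAlgebra K V ⊗[K] TensorAlgebra K V :=
  ∑ i ∈ Finset.range (l.length + 1), word K (l.take i) ⊗ₜ[K] word K (l.drop i)

theorem slotLinear_deconcWord : SlotLinear K (deconcWord K (V := V)) := by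
  intro l₁ l₂
  have hl : ∀ i, IsLinearMap K fun a : V =>
      word K ((l₁ ++ a :: l₂).take i) ⊗ₜ[K] word K ((l₁ ++ a :: l₂).drop i) := by
    intro i
    rcases le_or_gt i l₁.length with hi | hi
    · simp only [List.take_append_of_le_length hi, List.drop_append_of_le_length hi]
      exact ⟨fun a b => by rw [(slotLinear_word _ _).map_add, TensorProduct.tmul_add],
        fun c a => by rw [(slotLinear_word _ _).map_smul, TensorProduct.tmul_smul]⟩
    · obtain ⟨j, rfl⟩ := Nat.exists_eq_add_of_lt hi
      have e1 : ∀ a : V, (l₁ ++ a :: l₂).take (l₁.length + j + 1) = l₁ ++ a :: l₂.take j := by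
        intro a; rw [add_assoc, List.take_length_add_append]; rfl
      have e2 : ∀ a : V, (l₁ ++ a :: l₂).drop (l₁.length + j + 1) = l₂.drop j := by
        intro a; rw [add_assoc, List.drop_length_add_append]; rfl
      simp only [e1, e2]
      exact ⟨fun a b => by rw [(slotLinear_word _ _).map_add, TensorProduct.add_tmul],
        fun c a => by rw [(slotLinear_word _ _).map_smul, TensorProduct.smul_tmul']⟩
  constructor
  · intro a b
    simp only [deconcWord, (hl _).map_add, ← Finset.sum_add_distrib, List.length_append,
      List.length_cons]
  · intro c a
    simp only [deconcWord, (hl _).map_smul, Finset.smul_sum, List.length_append,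
      List.length_cons]

variable (V) in
/-- The coproduct `Δ` (deconcatenation) of `QSh(V)`. -/
def deconc : TensorAlgebra K V →ₗ[K] TensorAlgebra K V ⊗[K] TensorAlgebra K V :=
  (slotLinear_deconcWord K).extend

theorem deconc_word (l : List V) : deconc K V (word K l) = deconcWord K l := by
  simp [deconc]

variable (V) in
/-- The counit `ε_Δ` of deconcatenation: the projection onto words of length `0`. -/
def deconcCounit : TensorAlgebra K V →ₗ[K] K := TensorAlgebra.algebraMapInv.toLinearMap

theorem slotLinear_qshWord_left [IsScalarTower K V V] (l : List V) : SlotLinear K fun k : List V => qshWord K k l := by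
  suffices h : ∀ k₁ k₂ l : List V, IsLinearMap K fun a : V => qshWord K (k₁ ++ a :: k₂) l from
    fun k₁ k₂ => h k₁ k₂ l
  intro k₁ k₂
  induction k₁ with
  | nil =>
    intro l
    induction l with
    | nil => simpa only [List.nil_append, qshWord] using slotLinear_word (K := K) [] k₂
    | cons b l ih =>
      simp only [List.nil_append] at ih
      simp only [List.nil_append, qshWord]
      exact ⟨fun a a' => by simp only [ih.map_add, map_add, add_mul, mul_add]; abel,
        fun c a => by simp only [ih.map_smul, map_smul, smul_mul_assoc, mul_smul_comm, smul_add]⟩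
  | cons d k₁ ih₁ =>
    intro l
    induction l with
    | nil =>
      simpa only [List.cons_append, qshWord] using slotLinear_word (K := K) (d :: k₁) k₂
    | cons b l ih =>
      simp only [List.cons_append] at ih
      simp only [List.cons_append, qshWord]
      exact ⟨fun a a' => by
          simp only [ih.map_add, (ih₁ _).map_add, mul_add]; abel,
        fun c a => by
          simp only [ih.map_smul, (ih₁ _).map_smul, mul_smul_comm, smul_add]⟩

theorem slotLinear_qshWord_right [SMulCommClass K V V] (k : List V) : SlotLinear K (qshWord K k) := by
  suffices h : ∀ l₁ l₂ k : List V, IsLinearMap K fun a : V => qshWord K k (l₁ ++ a :: l₂) from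
    fun l₁ l₂ => h l₁ l₂ k
  intro l₁ l₂
  induction l₁ with
  | nil =>
    intro k
    induction k with
    | nil => simpa only [List.nil_append, qshWord] using slotLinear_word (K := K) [] l₂
    | cons b k ih =>
      simp only [List.nil_append] at ih
      simp only [List.nil_append, qshWord]
      exact ⟨fun a a' => by simp only [ih.map_add, map_add, add_mul, mul_add]; abel,
        fun c a => by simp only [ih.map_smul, map_smul, smul_mul_assoc, mul_smul_comm, smul_add]⟩
  | cons d l₁ ih₁ =>
    intro k
    induction k with
    | nil =>
      simpa only [List.cons_append, qshWord] using slotLinear_word (K := K) (d :: l₁) l₂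
    | cons b k ih =>
      simp only [List.cons_append] at ih
      simp only [List.cons_append, qshWord]
      exact ⟨fun a a' => by
          simp only [ih.map_add, (ih₁ _).map_add, mul_add]; abel,
        fun c a => by
          simp only [ih.map_smul, (ih₁ _).map_smul, mul_smul_comm, smul_add]⟩

variable [IsScalarTower K V V] [SMulCommClass K V V]

theorem slotLinear_qshWord_extend :
    SlotLinear K fun k : List V => (slotLinear_qshWord_right K k).extend := fun k₁ k₂ =>
  ⟨fun a b => linearMap_ext_word fun l => by
      simpa using (slotLinear_qshWord_left K l k₁ k₂).map_add a b,
    fun c a => linearMap_ext_word fun l => by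
      simpa using (slotLinear_qshWord_left K l k₁ k₂).map_smul c a⟩

variable (V) in
/-- The quasishuffle product `⧢` on `T(V)`, as a bilinear map. -/
def qsh : TensorAlgebra K V →ₗ[K] TensorAlgebra K V →ₗ[K] TensorAlgebra K V :=
  (slotLinear_qshWord_extend K).extend

theorem qsh_word_word (k l : List V) : qsh K V (word K k) (word K l) = qshWord K k l := by
  simp [qsh]

variable (V) in
/-- The quasishuffle bialgebra `(T(V), ⧢, Δ)` (structure maps). -/
def qshOps : BialgOps K (TensorAlgebra K V) where
  mul := TensorProduct.lift (qsh K V)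
  one := 1
  comul := deconc K V
  counit := deconcCounit K V

variable [NonunitalBialgebra K V]

variable (V) in
/-- The coaction `ρ : T(V) → T(V) ⊗ uV`, `v₁...vₙ ↦ v₁'...vₙ' ⊗ v₁''·...·vₙ''`: in the tensor
product of the algebras `T(V)` (with concatenation) and `uV`, the image of `v₁...vₙ` is the
product of the elements `vᵢ' ⊗ vᵢ''`. -/
def coaction : TensorAlgebra K V →ₗ[K] TensorAlgebra K V ⊗[K] Unitization K V :=
  (TensorAlgebra.lift K
    (TensorProduct.map (TensorAlgebra.ι K) (incl K V) ∘ₗ Coalgebra.comul)).toLinearMap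

variable (V) in
/-- The linear map `T(V) → T(V) ⊗ T(V)` with `1 ↦ 0` and
`v₁...vₙ ↦ (v₁'·...·vₙ') ⊗ v₁''...vₙ''` for `n ≥ 1`, where the left factor is a word of length 1.
(The element `(v₁'·...·vₙ') ⊗ v₁''...vₙ''` of `uV ⊗ T(V)` is computed as a product, and then `uV`
is projected onto `V`.) -/
def block : TensorAlgebra K V →ₗ[K] TensorAlgebra K V ⊗[K] TensorAlgebra K V :=
  TensorProduct.map (TensorAlgebra.ι K ∘ₗ proj K V) LinearMap.id ∘ₗ
    (TensorAlgebra.lift K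
      (TensorProduct.map (incl K V) (TensorAlgebra.ι K) ∘ₗ Coalgebra.comul)).toLinearMap

variable (V) in
/-- The product `(a ⊗ b) ⋆ (c ⊗ d) = ac ⊗ (b ⧢ d)` on `T(V) ⊗ T(V)`: concatenation on the left,
quasishuffle on the right. -/
def concQsh : TensorAlgebra K V ⊗[K] TensorAlgebra K V →ₗ[K]
    TensorAlgebra K V ⊗[K] TensorAlgebra K V →ₗ[K]
      TensorAlgebra K V ⊗[K] TensorAlgebra K V :=
  TensorProduct.map₂ (LinearMap.mul K (TensorAlgebra K V)) (qsh K V)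

/-- The second coproduct on words: the sum over all ways to cut `v₁...vₙ` into consecutive
nonempty blocks of
`(∏ of the first block of v') ... (∏ of the last block of v') ⊗`
`(first block of v'') ⧢ ... ⧢ (last block of v'')`.
The sum is organised according to the first block `v₁...vᵢ₊₁`. -/
def deltaWord : List V → TensorAlgebra K V ⊗[K] TensorAlgebra K V
  | [] => 1 ⊗ₜ 1
  | a :: l => ∑ i ∈ Finset.range (l.length + 1),
      concQsh K V (block K V (word K (a :: l.take i))) (deltaWord (l.drop i))
termination_by l => l.length
decreasing_by simp

theorem slotLinear_deltaWord : SlotLinear K (deltaWord K (V := V)) := by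
  suffices h : ∀ (n : ℕ) (l₁ l₂ : List V), l₁.length ≤ n →
      IsLinearMap K fun a : V => deltaWord K (l₁ ++ a :: l₂) from fun l₁ l₂ => h _ l₁ l₂ le_rfl
  intro n
  induction n with
  | zero =>
    intro l₁ l₂ h
    obtain rfl : l₁ = [] := by simpa using h
    simp only [List.nil_append, deltaWord, word_cons]
    exact ⟨fun a b => by
        simp only [map_add, add_mul, LinearMap.add_apply, Finset.sum_add_distrib],
      fun c a => by
        simp only [map_smul, smul_mul_assoc, LinearMap.smul_apply, Finset.smul_sum]⟩
  | succ n ih =>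
    intro l₁ l₂ h
    cases l₁ with
    | nil => exact ih [] l₂ (by simp)
    | cons d l₁ =>
      have hl : ∀ i, IsLinearMap K fun a : V =>
          concQsh K V (block K V (word K (d :: (l₁ ++ a :: l₂).take i)))
            (deltaWord K ((l₁ ++ a :: l₂).drop i)) := by
        intro i
        rcases le_or_gt i l₁.length with hi | hi
        · simp only [List.take_append_of_le_length hi, List.drop_append_of_le_length hi]
          have := ih (l₁.drop i) l₂ (by simp at h ⊢; omega)
          exact ⟨fun a b => by rw [this.map_add, map_add],
            fun c a => by rw [this.map_smul, map_smul]⟩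
        · obtain ⟨j, rfl⟩ := Nat.exists_eq_add_of_lt hi
          have e1 : ∀ a : V,
              (l₁ ++ a :: l₂).take (l₁.length + j + 1) = l₁ ++ a :: l₂.take j := by
            intro a; rw [add_assoc, List.take_length_add_append]; rfl
          have e2 : ∀ a : V, (l₁ ++ a :: l₂).drop (l₁.length + j + 1) = l₂.drop j := by
            intro a; rw [add_assoc, List.drop_length_add_append]; rfl
          simp only [e1, e2]
          have := slotLinear_word (K := K) (d :: l₁) (l₂.take j)
          simp only [List.cons_append] at this
          exact ⟨fun a b => by rw [this.map_add, map_add, map_add, LinearMap.add_apply],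
            fun c a => by rw [this.map_smul, map_smul, map_smul, LinearMap.smul_apply]⟩
      constructor
      · intro a b
        simp only [List.cons_append, deltaWord, (hl _).map_add, ← Finset.sum_add_distrib,
          List.length_append, List.length_cons]
      · intro c a
        simp only [List.cons_append, deltaWord, (hl _).map_smul, Finset.smul_sum,
          List.length_append, List.length_cons]

variable (V) in
/-- The second coproduct `δ` of `QSh(V)`. -/
def delta : TensorAlgebra K V →ₗ[K] TensorAlgebra K V ⊗[K] TensorAlgebra K V :=
  (slotLinear_deltaWord K).extend

theorem delta_word (l : List V) : delta K V (word K l) = deltaWord K l := by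
  simp [delta]

/-- The counit of `δ` on words: `1` on the empty word, `ε_V` on words of length `1`, and `0` on
longer words. -/
def deltaCounitWord : List V → K
  | [] => 1
  | [a] => Coalgebra.counit a
  | _ :: _ :: _ => 0

theorem slotLinear_deltaCounitWord : SlotLinear K (deltaCounitWord K (V := V)) := by
  intro l₁ l₂
  rcases l₁ with _ | ⟨b, _ | ⟨c, l₁⟩⟩ <;> rcases l₂ with _ | ⟨d, l₂⟩ <;>
    exact ⟨fun a b => by simp [deltaCounitWord], fun c a => by simp [deltaCounitWord]⟩

variable (V) in
/-- The counit `ε_δ` of `δ`. -/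
def deltaCounit : TensorAlgebra K V →ₗ[K] K := (slotLinear_deltaCounitWord K).extend

theorem deltaCounit_word (l : List V) : deltaCounit K V (word K l) = deltaCounitWord K l := by
  simp [deltaCounit]

end QSh

end QuasiShuffle

end

open scoped TensorProduct

noncomputable section

universe u v w

/-! The space T(V) carries two products, concatenation and the quasishuffle ⧢. By construction ρ is
an algebra morphism for concatenation. So the coaction axioms and the colinearity of Δ and of its
counit reduce to letters or to an induction on the length of a word, and hold for every V.

Commutativity is what makes ρ compatible with ⧢. Over a commutative algebra A, the quasishuffle of
T(V) ⊗ A obeys the three-term recursion with letters in V ⊗ A (`qshA_ιA_mul`), and ρ turns the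
recursion of T(V) into that of T(V) ⊗ uV (`coaction_qsh`). Conversely, applying ε_V to every letter
of the left factor in ρ(a ⧢ b) = ρ(a) ⧢ ρ(b) gives a·b + b·a + a·b = 3 a·b in uV, hence a·b = b·a.

For δ, let `QSh` be T(V) with ⧢ as multiplication, and view δ as a map `deltaQ` into the algebra
T(V) ⊗ QSh(V). When V is cocommutative, the contribution `blockQ` of one block is ρ with its two
factors exchanged. Splitting off the first block gives `deltaQ` = 1 + `blockQ` * `deltaQ`, where *
is the convolution attached to Δ and 1 its unit (`deltaQ_eq`). As `blockQ` vanishes on the empty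
word, this equation has only one solution (`eq_of_eq_add_conv`). The equation is transported by
algebra morphisms on the target (`algHom_comp_deltaQ`) and by Δ-colinear coactions on the source
(`deltaQ_rTensor_comp`). Uniqueness of solutions then yields the Δ-colinearity of δ, its
compatibility with ρ, the right counit axiom and coassociativity. Coassociativity also needs δ to be
multiplicative for ⧢; this is an induction on the total length of two words, using that Δ and the
block map respect ⧢ (`deltaQ_qsh_word`).

Conversely, the compatibility of δ and ρ on a letter a reads a' ⊗ a''' ⊗ a'' = a' ⊗ a'' ⊗ a''';
applying ε_V to the first factor gives cocommutativity. -/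

namespace QuasiShuffle

/-! ### Rearranging tensor factors. -/

section General

variable {K : Type u} [Field K]

/-- Two bilinear maps on the two pairs of tensor factors, in terms of their linear lifts. -/
theorem map_lift_lift_tensorTensorTensorComm {B C : Type*} [AddCommGroup B] [Module K B]
    [AddCommGroup C] [Module K C] (f : B →ₗ[K] B →ₗ[K] B) (g : C →ₗ[K] C →ₗ[K] C)
    (P Q : B ⊗[K] C) :
    TensorProduct.map (TensorProduct.lift f) (TensorProduct.lift g)
      (TensorProduct.tensorTensorTensorComm K B C B C (P ⊗ₜ Q)) =
        TensorProduct.map₂ f g P Q := by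
  induction P using TensorProduct.induction_on with
  | zero => simp
  | add P P' h h' => simp only [TensorProduct.add_tmul, map_add, h, h', LinearMap.add_apply]
  | tmul a b =>
    induction Q using TensorProduct.induction_on with
    | zero => simp
    | add Q Q' h h' => simp only [TensorProduct.tmul_add, map_add, h, h']
    | tmul c d => simp

theorem lTensor_rTensor_apply {B B' C C' : Type*} [AddCommGroup B] [Module K B]
    [AddCommGroup B'] [Module K B'] [AddCommGroup C] [Module K C] [AddCommGroup C'] [Module K C']
    (f : B →ₗ[K] B') (g : C →ₗ[K] C') (P : B ⊗[K] C) :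
    g.lTensor B' (f.rTensor C P) = f.rTensor C' (g.lTensor B P) := by
  rw [← LinearMap.comp_apply, ← LinearMap.comp_apply, LinearMap.lTensor_comp_rTensor,
    LinearMap.rTensor_comp_lTensor]

end General

/-! ### Deconcatenation is a counital coassociative coproduct. -/

section Deconcatenation

variable (K : Type u) {V : Type v} [Field K] [NonUnitalRing V] [Module K V]

theorem deconc_one : deconc K V 1 = 1 ⊗ₜ 1 := by
  simpa [deconcWord] using deconc_word K ([] : List V)

theorem deconc_word_cons (a : V) (l : List V) :
    deconc K V (word K (a :: l)) =
      1 ⊗ₜ word K (a :: l) + (TensorAlgebra.ι K a ⊗ₜ 1) * deconc K V (word K l) := by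
  simp only [deconc_word, deconcWord, List.length_cons]
  rw [Finset.sum_range_succ', add_comm, Finset.mul_sum]
  simp

theorem deconc_ι_mul (a : V) (x : TensorAlgebra K V) :
    deconc K V (TensorAlgebra.ι K a * x) =
      1 ⊗ₜ (TensorAlgebra.ι K a * x) + (TensorAlgebra.ι K a ⊗ₜ 1) * deconc K V x := by
  have h : deconc K V ∘ₗ LinearMap.mulLeft K (TensorAlgebra.ι K a) =
      TensorProduct.mk K _ _ 1 ∘ₗ LinearMap.mulLeft K (TensorAlgebra.ι K a) +
        LinearMap.mulLeft K (TensorAlgebra.ι K a ⊗ₜ 1) ∘ₗ deconc K V :=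
    linearMap_ext_word fun l => by simpa using deconc_word_cons K a l
  simpa using LinearMap.congr_fun h x

@[simp] theorem deconcCounit_one : deconcCounit K V 1 = 1 := by
  simp [deconcCounit]

@[simp] theorem deconcCounit_ι_mul (a : V) (x : TensorAlgebra K V) :
    deconcCounit K V (TensorAlgebra.ι K a * x) = 0 := by
  simp [deconcCounit, TensorAlgebra.algebraMapInv]

@[simp] theorem deconcCounit_word_cons (a : V) (l : List V) :
    deconcCounit K V (word K (a :: l)) = 0 := by
  simp

theorem deconcCounit_rTensor_deconc (x : TensorAlgebra K V) :
    (deconcCounit K V).rTensor (TensorAlgebra K V) (deconc K V x) = 1 ⊗ₜ x := by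
  suffices h : (deconcCounit K V).rTensor (TensorAlgebra K V) ∘ₗ deconc K V =
      TensorProduct.mk K _ _ 1 from LinearMap.congr_fun h x
  refine linearMap_ext_word fun l => ?_
  cases l with
  | nil => simp [deconc_one]
  | cons a l =>
    have h : ∀ P : TensorAlgebra K V ⊗[K] TensorAlgebra K V,
        (deconcCounit K V).rTensor (TensorAlgebra K V) ((TensorAlgebra.ι K a ⊗ₜ 1) * P) = 0 := by
      intro P
      induction P using TensorProduct.induction_on with
      | zero => simp
      | add P Q hP hQ => simp only [mul_add, map_add, hP, hQ, add_zero]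
      | tmul b c => simp
    simp [deconc_ι_mul, h]

theorem deconcCounit_lTensor_deconc (x : TensorAlgebra K V) :
    (deconcCounit K V).lTensor (TensorAlgebra K V) (deconc K V x) = x ⊗ₜ 1 := by
  suffices h : (deconcCounit K V).lTensor (TensorAlgebra K V) ∘ₗ deconc K V =
      (TensorProduct.mk K _ _).flip 1 from LinearMap.congr_fun h x
  refine linearMap_ext_word fun l => ?_
  induction l with
  | nil => simp [deconc_one]
  | cons a l ih =>
    have h : ∀ P : TensorAlgebra K V ⊗[K] TensorAlgebra K V,
        (deconcCounit K V).lTensor (TensorAlgebra K V) ((TensorAlgebra.ι K a ⊗ₜ 1) * P) =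
          (TensorAlgebra.ι K a ⊗ₜ 1) * (deconcCounit K V).lTensor (TensorAlgebra K V) P := by
      intro P
      induction P using TensorProduct.induction_on with
      | zero => simp
      | add P Q hP hQ => simp only [mul_add, map_add, hP, hQ]
      | tmul b c => simp
    simp only [LinearMap.comp_apply, LinearMap.flip_apply, TensorProduct.mk_apply] at ih
    simp [deconc_ι_mul, h, ih]

/-- Both iterated coproducts D satisfy D(al) = 1 ⊗ Δ(al) + (a ⊗ 1 ⊗ 1) D(l) for a letter a; `h1` and
`h3` provide the two instances. -/
theorem deconc_coassoc :
    (TensorProduct.assoc K _ _ _).toLinearMap ∘ₗ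
      (deconc K V).rTensor (TensorAlgebra K V) ∘ₗ deconc K V =
    (deconc K V).lTensor (TensorAlgebra K V) ∘ₗ deconc K V := by
  refine linearMap_ext_word fun l => ?_
  induction l with
  | nil => simp [deconc_one]
  | cons a l ih =>
    have h1 : ∀ P : TensorAlgebra K V ⊗[K] TensorAlgebra K V,
        TensorProduct.assoc K _ _ _ ((deconc K V).rTensor (TensorAlgebra K V)
          ((TensorAlgebra.ι K a ⊗ₜ 1) * P)) =
          1 ⊗ₜ ((TensorAlgebra.ι K a ⊗ₜ 1) * P) + (TensorAlgebra.ι K a ⊗ₜ (1 ⊗ₜ 1)) *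
            TensorProduct.assoc K _ _ _ ((deconc K V).rTensor (TensorAlgebra K V) P) := by
      intro P
      induction P using TensorProduct.induction_on with
      | zero => simp
      | add P Q hP hQ =>
        simp only [mul_add, map_add, hP, hQ, TensorProduct.tmul_add]
        abel
      | tmul b c =>
        have h2 : ∀ Q : TensorAlgebra K V ⊗[K] TensorAlgebra K V,
            TensorProduct.assoc K _ _ _ (((TensorAlgebra.ι K a ⊗ₜ 1) * Q) ⊗ₜ c) =
              (TensorAlgebra.ι K a ⊗ₜ (1 ⊗ₜ 1)) * TensorProduct.assoc K _ _ _ (Q ⊗ₜ c) := by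
          intro Q
          induction Q using TensorProduct.induction_on with
          | zero => simp
          | add P Q hP hQ => simp only [mul_add, map_add, hP, hQ, TensorProduct.add_tmul]
          | tmul d e => simp
        simp [deconc_ι_mul, TensorProduct.add_tmul, h2]
    have h3 : ∀ P : TensorAlgebra K V ⊗[K] TensorAlgebra K V,
        (deconc K V).lTensor (TensorAlgebra K V) ((TensorAlgebra.ι K a ⊗ₜ 1) * P) =
          (TensorAlgebra.ι K a ⊗ₜ (1 ⊗ₜ 1)) * (deconc K V).lTensor (TensorAlgebra K V) P := by
      intro P
      induction P using TensorProduct.induction_on with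
      | zero => simp
      | add P Q hP hQ => simp only [mul_add, map_add, hP, hQ]
      | tmul b c =>
        simp only [Algebra.TensorProduct.tmul_mul_tmul, LinearMap.lTensor_tmul, one_mul]
        rw [← Algebra.TensorProduct.one_def, one_mul]
    simp only [LinearMap.comp_apply, LinearEquiv.coe_coe] at ih ⊢
    rw [deconc_word_cons, map_add, map_add, map_add, h1, h3, ih]
    simp only [LinearMap.rTensor_tmul, LinearMap.lTensor_tmul, deconc_one,
      TensorProduct.assoc_tmul, deconc_word_cons, TensorProduct.tmul_add]
    abel

end Deconcatenation

/-! ### The quasishuffle algebra. -/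

section QuasiShuffleAlgebra

variable (K : Type u) {V : Type v} [Field K] [NonUnitalRing V] [Module K V]
  [IsScalarTower K V V] [SMulCommClass K V V]

theorem one_qsh (x : TensorAlgebra K V) : qsh K V 1 x = x := by
  suffices h : qsh K V 1 = LinearMap.id from LinearMap.congr_fun h x
  exact linearMap_ext_word fun l => by simpa [qshWord] using qsh_word_word K [] l

theorem qsh_one (x : TensorAlgebra K V) : qsh K V x 1 = x := by
  suffices h : (qsh K V).flip 1 = LinearMap.id from LinearMap.congr_fun h x
  refine linearMap_ext_word fun l => ?_
  have := qsh_word_word K l []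
  cases l <;> simpa [qshWord] using this

/-- Bilinearity frees the defining recursion from words; all later computations with ⧢ go through
this form. -/
theorem qsh_ι_mul_ι_mul (a b : V) (x y : TensorAlgebra K V) :
    qsh K V (TensorAlgebra.ι K a * x) (TensorAlgebra.ι K b * y) =
      TensorAlgebra.ι K a * qsh K V x (TensorAlgebra.ι K b * y) +
      TensorAlgebra.ι K b * qsh K V (TensorAlgebra.ι K a * x) y +
      TensorAlgebra.ι K (a * b) * qsh K V x y := by
  have h : (qsh K V).compl₁₂ (LinearMap.mulLeft K (TensorAlgebra.ι K a))
        (LinearMap.mulLeft K (TensorAlgebra.ι K b)) =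
      ((qsh K V).compl₁₂ LinearMap.id (LinearMap.mulLeft K (TensorAlgebra.ι K b))).compr₂
        (LinearMap.mulLeft K (TensorAlgebra.ι K a)) +
      ((qsh K V).compl₁₂ (LinearMap.mulLeft K (TensorAlgebra.ι K a)) LinearMap.id).compr₂
        (LinearMap.mulLeft K (TensorAlgebra.ι K b)) +
      (qsh K V).compr₂ (LinearMap.mulLeft K (TensorAlgebra.ι K (a * b))) := by
    refine linearMap_ext_word fun k => linearMap_ext_word fun l => ?_
    have := qsh_word_word K (a :: k) (b :: l)
    rw [qshWord, ← qsh_word_word, ← qsh_word_word, ← qsh_word_word] at this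
    simpa using this
  simpa using LinearMap.congr_fun (LinearMap.congr_fun h x) y

theorem qsh_ι_ι (a b : V) : qsh K V (TensorAlgebra.ι K a) (TensorAlgebra.ι K b) =
    TensorAlgebra.ι K a * TensorAlgebra.ι K b + TensorAlgebra.ι K b * TensorAlgebra.ι K a +
      TensorAlgebra.ι K (a * b) := by
  simpa [one_qsh, qsh_one] using qsh_ι_mul_ι_mul K a b 1 1

theorem qsh_assoc_word (k l m : List V) :
    qsh K V (qsh K V (word K k) (word K l)) (word K m) =
      qsh K V (word K k) (qsh K V (word K l) (word K m)) := by
  induction k generalizing l m with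
  | nil => simp [one_qsh]
  | cons a k ihk =>
    induction l generalizing m with
    | nil => simp [one_qsh, qsh_one]
    | cons b l ihl =>
      induction m with
      | nil => simp [qsh_one]
      | cons c m ihm =>
        have h1 := ihk (b :: l) (c :: m)
        have h2 := ihk l (c :: m)
        have h3 := ihk (b :: l) m
        have h4 := ihk l m
        have h5 := ihl (c :: m)
        have h6 := ihl m
        simp only [word_cons, qsh_ι_mul_ι_mul, map_add, LinearMap.add_apply] at *
        -- The seven smaller cases are those where at least one of the three words loses its first
        -- letter. In `h1` the expansion sits on the right and in `ihm` on the left, which is why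
        -- they are used in opposite directions.
        simp only [← h2, ← h3, ← h4, ← h5, ← h6, ← ihm, h1, mul_add, mul_assoc]
        abel

theorem qsh_assoc (x y z : TensorAlgebra K V) :
    qsh K V (qsh K V x y) z = qsh K V x (qsh K V y z) := by
  -- Both sides are packed as trilinear maps, so that extensionality on words applies three times.
  have h : (qsh K V).compr₂ (qsh K V) =
      ((LinearMap.llcomp K (TensorAlgebra K V) (TensorAlgebra K V) (TensorAlgebra K V)) ∘ₗ
        qsh K V).compl₂ (qsh K V) :=
    linearMap_ext_word fun k => linearMap_ext_word fun l => linearMap_ext_word fun m =>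
      qsh_assoc_word K k l m
  exact LinearMap.congr_fun (LinearMap.congr_fun (LinearMap.congr_fun h x) y) z

/-- The vector space `T(V)` with the quasishuffle product as multiplication. -/
def QSh (K : Type u) (V : Type v) [Field K] [NonUnitalRing V] [Module K V] : Type (max u v) :=
  TensorAlgebra K V

instance : Ring (QSh K V) where
  __ := (inferInstance : AddCommGroup (TensorAlgebra K V))
  mul x y := qsh K V x y
  one := (1 : TensorAlgebra K V)
  mul_assoc := qsh_assoc K
  one_mul := one_qsh K
  mul_one := qsh_one K
  left_distrib x := (qsh K V x).map_add
  right_distrib x y z := (qsh K V).map_add₂ x y z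
  zero_mul x := (qsh K V).map_zero₂ x
  mul_zero x := (qsh K V x).map_zero

instance : Algebra K (QSh K V) :=
  letI : Module K (QSh K V) := (inferInstance : Module K (TensorAlgebra K V))
  Algebra.ofModule (fun r x y => (qsh K V).map_smul₂ r x y) (fun r x y => (qsh K V x).map_smul r y)

theorem qsh_comm_word (hV : ∀ a b : V, a * b = b * a) (k l : List V) :
    qsh K V (word K k) (word K l) = qsh K V (word K l) (word K k) := by
  induction k generalizing l with
  | nil => simp [one_qsh, qsh_one]
  | cons a k ihk =>
    induction l with
    | nil => simp [one_qsh, qsh_one]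
    | cons b l ihl =>
      simp only [word_cons, qsh_ι_mul_ι_mul] at *
      rw [← word_cons, ihk, ihk l, ihl, hV a b]
      simp only [word_cons]
      abel

theorem qsh_comm (hV : ∀ a b : V, a * b = b * a) (x y : TensorAlgebra K V) :
    qsh K V x y = qsh K V y x := by
  have h : qsh K V = (qsh K V).flip :=
    linearMap_ext_word fun k => linearMap_ext_word fun l => qsh_comm_word K hV k l
  exact LinearMap.congr_fun (LinearMap.congr_fun h x) y

theorem QSh.mul_comm (hV : ∀ a b : V, a * b = b * a) (x y : QSh K V) : x * y = y * x :=
  qsh_comm K hV x y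

variable (V) in
/-- The identity, as a linear isomorphism from `T(V)` to the quasishuffle algebra. -/
def QSh.of : TensorAlgebra K V ≃ₗ[K] QSh K V where
  toFun x := x
  invFun x := x
  map_add' _ _ := rfl
  map_smul' _ _ := rfl
  left_inv _ := rfl
  right_inv _ := rfl

theorem QSh.of_one : QSh.of K V 1 = 1 := rfl

theorem QSh.of_qsh (x y : TensorAlgebra K V) :
    QSh.of K V (qsh K V x y) = QSh.of K V x * QSh.of K V y := rfl

/-! ### The quasishuffle product with coefficients in an algebra A. -/

section BaseChange

variable (V) (A : Type w) [Ring A] [Algebra K A]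

/-- The inclusion `V ⊗ A → T(V) ⊗ A`. -/
def ιA : V ⊗[K] A →ₗ[K] TensorAlgebra K V ⊗[K] A := (TensorAlgebra.ι K).rTensor A

/-- The quasishuffle product of `T(V) ⊗ A`. -/
def qshA : TensorAlgebra K V ⊗[K] A →ₗ[K] TensorAlgebra K V ⊗[K] A →ₗ[K] TensorAlgebra K V ⊗[K] A :=
  TensorProduct.map₂ (qsh K V) (LinearMap.mul K A)

variable {V A}

theorem lTensor_of_map₂_qsh_qsh (P Q : TensorAlgebra K V ⊗[K] TensorAlgebra K V) :
    (QSh.of K V).toLinearMap.lTensor _ (TensorProduct.map₂ (qsh K V) (qsh K V) P Q) =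
      qshA K V (QSh K V) ((QSh.of K V).toLinearMap.lTensor _ P)
        ((QSh.of K V).toLinearMap.lTensor _ Q) := by
  induction P using TensorProduct.induction_on with
  | zero => simp
  | add P P' h h' => simp only [map_add, LinearMap.add_apply, h, h']
  | tmul a b =>
    induction Q using TensorProduct.induction_on with
    | zero => simp
    | add Q Q' h h' => simp only [map_add, h, h']
    | tmul c d => simp [qshA, QSh.of_qsh]

theorem one_qshA (P : TensorAlgebra K V ⊗[K] A) : qshA K V A 1 P = P := by
  induction P using TensorProduct.induction_on with
  | zero => simp
  | add P Q hP hQ => rw [map_add, hP, hQ]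
  | tmul x a => simp [qshA, Algebra.TensorProduct.one_def, one_qsh]

theorem qshA_one (P : TensorAlgebra K V ⊗[K] A) : qshA K V A P 1 = P := by
  induction P using TensorProduct.induction_on with
  | zero => simp
  | add P Q hP hQ => rw [map_add, LinearMap.add_apply, hP, hQ]
  | tmul x a => simp [qshA, Algebra.TensorProduct.one_def, qsh_one]

/-- In the right factor only b has to be moved past other coefficients, so centrality of b suffices.
The case b = 1 covers deconcatenation, where `QSh` need not be commutative. -/
theorem qshA_ι_tmul_mul (a : A) {b : A} (hb : ∀ c, b * c = c * b) (x y : V)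
    (P Q : TensorAlgebra K V ⊗[K] A) :
    qshA K V A (TensorAlgebra.ι K x ⊗ₜ a * P) (TensorAlgebra.ι K y ⊗ₜ b * Q) =
      TensorAlgebra.ι K x ⊗ₜ a * qshA K V A P (TensorAlgebra.ι K y ⊗ₜ b * Q) +
      TensorAlgebra.ι K y ⊗ₜ b * qshA K V A (TensorAlgebra.ι K x ⊗ₜ a * P) Q +
      TensorAlgebra.ι K (x * y) ⊗ₜ (a * b) * qshA K V A P Q := by
  induction P using TensorProduct.induction_on with
  | zero => simp
  | add P P' h h' =>
    simp only [mul_add, map_add, LinearMap.add_apply, h, h']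
    abel
  | tmul p c =>
    induction Q using TensorProduct.induction_on with
    | zero => simp
    | add Q Q' h h' =>
      simp only [mul_add, map_add, h, h']
      abel
    | tmul q d =>
      have h1 : a * c * (b * d) = a * (c * (b * d)) := mul_assoc _ _ _
      have h2 : b * (a * c * d) = a * (c * (b * d)) := by
        rw [hb, mul_assoc a c d, mul_assoc a, mul_assoc c, ← hb d]
      have h3 : a * b * (c * d) = a * (c * (b * d)) := by
        rw [mul_assoc a, ← mul_assoc b c, hb c, mul_assoc c]
      simp only [qshA, Algebra.TensorProduct.tmul_mul_tmul, TensorProduct.map₂_apply_tmul,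
        TensorProduct.map_tmul, LinearMap.mul_apply', qsh_ι_mul_ι_mul, TensorProduct.add_tmul, h1, h2, h3]

theorem qshA_ιA_mul (hA : ∀ a b : A, a * b = b * a) (p q : V ⊗[K] A)
    (P Q : TensorAlgebra K V ⊗[K] A) :
    qshA K V A (ιA K V A p * P) (ιA K V A q * Q) =
      ιA K V A p * qshA K V A P (ιA K V A q * Q) +
      ιA K V A q * qshA K V A (ιA K V A p * P) Q +
      ιA K V A (p * q) * qshA K V A P Q := by
  induction p using TensorProduct.induction_on with
  | zero => simp
  | add p p' h h' =>
    simp only [add_mul, mul_add, map_add, LinearMap.add_apply, h, h']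
    abel
  | tmul x a =>
    induction q using TensorProduct.induction_on with
    | zero => simp
    | add q q' h h' =>
      simp only [add_mul, mul_add, map_add, h, h']
      abel
    | tmul y b => simpa [ιA] using qshA_ι_tmul_mul K a (hA b) x y P Q

end BaseChange

end QuasiShuffleAlgebra

/-! ### Deconcatenation is multiplicative for the quasishuffle. -/

section DeconcatenationMultiplicative

variable (K : Type u) {V : Type v} [Field K] [NonUnitalRing V] [Module K V]

variable {A : Type w} [Ring A] [Algebra K A]

theorem tmul_one_mul (x : TensorAlgebra K V) (P : TensorAlgebra K V ⊗[K] A) :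
    x ⊗ₜ 1 * P = (LinearMap.mulLeft K x).rTensor A P := by
  induction P using TensorProduct.induction_on with
  | zero => simp
  | add P P' h h' => rw [mul_add, map_add, h, h']
  | tmul y a => simp

variable [IsScalarTower K V V] [SMulCommClass K V V]

theorem lTensor_mul_of_map_mul {f : V →ₗ[K] A} (hf : ∀ a b, f (a * b) = f a * f b)
    (x y : V ⊗[K] V) : f.lTensor V (x * y) = f.lTensor V x * f.lTensor V y := by
  induction x using TensorProduct.induction_on with
  | zero => simp
  | add x x' h h' => simp only [add_mul, map_add, h, h']
  | tmul a b =>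
    induction y using TensorProduct.induction_on with
    | zero => simp
    | add y y' h h' => simp only [mul_add, map_add, h, h']
    | tmul c d => simp [hf]

theorem qshA_one_tmul_ι_mul (u : A) (y : V) (Q : TensorAlgebra K V ⊗[K] A) :
    qshA K V A (1 ⊗ₜ u) ((LinearMap.mulLeft K (TensorAlgebra.ι K y)).rTensor A Q) =
      (LinearMap.mulLeft K (TensorAlgebra.ι K y)).rTensor A (qshA K V A (1 ⊗ₜ u) Q) := by
  induction Q using TensorProduct.induction_on with
  | zero => simp
  | add P P' h h' => simp only [map_add, h, h']
  | tmul y a => simp [qshA, one_qsh]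

theorem qshA_ι_mul_one_tmul (u : A) (x : V) (P : TensorAlgebra K V ⊗[K] A) :
    qshA K V A ((LinearMap.mulLeft K (TensorAlgebra.ι K x)).rTensor A P) (1 ⊗ₜ u) =
      (LinearMap.mulLeft K (TensorAlgebra.ι K x)).rTensor A (qshA K V A P (1 ⊗ₜ u)) := by
  induction P using TensorProduct.induction_on with
  | zero => simp
  | add P P' h h' => simp only [map_add, LinearMap.add_apply, h, h']
  | tmul y a => simp [qshA, qsh_one]

variable (V) in
/-- Deconcatenation, with the second tensor factor seen in the quasishuffle algebra. -/
def deconcQ : TensorAlgebra K V →ₗ[K] TensorAlgebra K V ⊗[K] QSh K V :=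
  (QSh.of K V).toLinearMap.lTensor _ ∘ₗ deconc K V

theorem deconcQ_ι_mul (a : V) (x : TensorAlgebra K V) :
    deconcQ K V (TensorAlgebra.ι K a * x) =
      1 ⊗ₜ QSh.of K V (TensorAlgebra.ι K a * x) +
        (LinearMap.mulLeft K (TensorAlgebra.ι K a)).rTensor (QSh K V) (deconcQ K V x) := by
  simp only [deconcQ, LinearMap.comp_apply, deconc_ι_mul, map_add, tmul_one_mul]
  congr 1
  exact lTensor_rTensor_apply _ _ _

theorem deconcQ_one : deconcQ K V 1 = 1 := by
  simp [deconcQ, deconc_one, QSh.of_one, Algebra.TensorProduct.one_def]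

/-- Write Δ(ax) = 1 ⊗ ax + (a ⊗ 1)Δ(x) for both arguments. The product of the two second terms
expands by the three-term recursion, the mixed products complete its first two terms, and the
remaining product is 1 ⊗ (ax ⧢ by). -/
theorem deconcQ_qsh_word (k l : List V) :
    deconcQ K V (qsh K V (word K k) (word K l)) =
      qshA K V (QSh K V) (deconcQ K V (word K k)) (deconcQ K V (word K l)) := by
  induction k generalizing l with
  | nil => rw [word_nil, one_qsh, deconcQ_one, one_qshA]
  | cons a k ihk =>
    induction l with
    | nil => rw [word_nil, qsh_one, deconcQ_one, qshA_one]
    | cons b l ihl =>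
      have h1 := ihk (b :: l)
      have h2 := ihk l
      simp only [word_cons] at *
      have h3 := qshA_ι_tmul_mul K (1 : QSh K V) (b := 1) (fun c => by simp) a b
        (deconcQ K V (word K k)) (deconcQ K V (word K l))
      simp only [tmul_one_mul, mul_one] at h3
      have h4 : ∀ x y : TensorAlgebra K V, qshA K V (QSh K V) (1 ⊗ₜ QSh.of K V x)
          (1 ⊗ₜ QSh.of K V y) = 1 ⊗ₜ QSh.of K V (qsh K V x y) := fun x y => by
        simp [qshA, one_qsh, QSh.of_qsh]
      rw [qsh_ι_mul_ι_mul, map_add, map_add, deconcQ_ι_mul, deconcQ_ι_mul, deconcQ_ι_mul, h1, h2,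
        ihl, deconcQ_ι_mul, deconcQ_ι_mul]
      simp only [map_add, LinearMap.add_apply, h3, h4, qshA_one_tmul_ι_mul, qshA_ι_mul_one_tmul,
        qsh_ι_mul_ι_mul, TensorProduct.tmul_add]
      abel

theorem deconcQ_qsh (x y : TensorAlgebra K V) :
    deconcQ K V (qsh K V x y) = qshA K V (QSh K V) (deconcQ K V x) (deconcQ K V y) := by
  have h : (qsh K V).compr₂ (deconcQ K V) =
      (qshA K V (QSh K V)).compl₁₂ (deconcQ K V) (deconcQ K V) :=
    linearMap_ext_word fun k => linearMap_ext_word fun l => deconcQ_qsh_word K k l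
  exact LinearMap.congr_fun (LinearMap.congr_fun h x) y

theorem lTensor_of_injective {B : Type*} [AddCommGroup B] [Module K B] :
    Function.Injective ((QSh.of K V).toLinearMap.lTensor B) :=
  (LinearEquiv.lTensor B (QSh.of K V)).injective

theorem deconc_qsh (x y : TensorAlgebra K V) :
    deconc K V (qsh K V x y) =
      TensorProduct.map₂ (qsh K V) (qsh K V) (deconc K V x) (deconc K V y) := by
  refine lTensor_of_injective K ?_
  rw [lTensor_of_map₂_qsh_qsh]
  exact deconcQ_qsh K x y

theorem deconcCounit_qsh (x y : TensorAlgebra K V) :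
    deconcCounit K V (qsh K V x y) = deconcCounit K V x * deconcCounit K V y := by
  have h : (qsh K V).compr₂ (deconcCounit K V) =
      (LinearMap.mul K K).compl₁₂ (deconcCounit K V) (deconcCounit K V) := by
    refine linearMap_ext_word fun k => linearMap_ext_word fun l => ?_
    cases k <;> cases l <;> simp [qsh_ι_mul_ι_mul, one_qsh, qsh_one]
  exact LinearMap.congr_fun (LinearMap.congr_fun h x) y

theorem qshOps_isBialgebra : (qshOps K V).IsBialgebra where
  mul_assoc x y z := by simpa [qshOps] using qsh_assoc K x y z
  one_mul x := by simpa [qshOps] using one_qsh K x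
  mul_one x := by simpa [qshOps] using qsh_one K x
  coassoc := deconc_coassoc K
  counit_left := deconcCounit_rTensor_deconc K
  counit_right := deconcCounit_lTensor_deconc K
  comul_one := deconc_one K
  counit_one := deconcCounit_one K
  comul_mul := TensorProduct.ext' fun x y => by
    simp [qshOps, map_lift_lift_tensorTensorTensorComm, deconc_qsh]
  counit_mul x y := by simpa [qshOps] using deconcCounit_qsh K x y

end DeconcatenationMultiplicative

/-! ### The coaction ρ: axioms and compatibility with the quasishuffle. -/

section Coaction

variable (K : Type u) {V : Type v} [Field K] [NonUnitalRing V] [Module K V]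
  [IsScalarTower K V V] [SMulCommClass K V V] [NonunitalBialgebra K V]

variable (V) in
/-- The coaction `ρ` as a morphism of algebras, for the concatenation product on `T(V)`. -/
def coactionHom : TensorAlgebra K V →ₐ[K] TensorAlgebra K V ⊗[K] Unitization K V :=
  TensorAlgebra.lift K (TensorProduct.map (TensorAlgebra.ι K) (incl K V) ∘ₗ Coalgebra.comul)

theorem coactionHom_apply (x : TensorAlgebra K V) : coactionHom K V x = coaction K V x := rfl

theorem coaction_one : coaction K V 1 = 1 := map_one (coactionHom K V)

theorem coaction_mul (x y : TensorAlgebra K V) :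
    coaction K V (x * y) = coaction K V x * coaction K V y := map_mul (coactionHom K V) x y

theorem coaction_ι (a : V) : coaction K V (TensorAlgebra.ι K a) =
    ιA K V (Unitization K V) ((incl K V).lTensor V (Coalgebra.comul a)) := by
  rw [← coactionHom_apply, coactionHom, TensorAlgebra.lift_ι_apply, ιA, ← LinearMap.comp_apply,
    LinearMap.rTensor_comp_lTensor, LinearMap.comp_apply]

/-- Factoring ρ on letters through the coproduct of uV makes the coalgebra axioms of uV directly
applicable. -/
theorem coaction_ι' (a : V) : coaction K V (TensorAlgebra.ι K a) =
    (TensorAlgebra.ι K ∘ₗ proj K V).rTensor (Unitization K V)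
      (uComul K V (Unitization.inr a)) := by
  rw [← coactionHom_apply, coactionHom, TensorAlgebra.lift_ι_apply, uComul_inr,
    LinearMap.comp_apply]
  generalize (Coalgebra.comul a : V ⊗[K] V) = P
  induction P using TensorProduct.induction_on with
  | zero => simp
  | add P P' h h' => simp only [map_add, h, h']
  | tmul a b => simp

/-- Both sides vanish at 1, so the formula for letters extends to all of uV and can be applied
inside the first factor of `uComul`. -/
theorem coaction_ι_proj (x : Unitization K V) :
    coaction K V (TensorAlgebra.ι K (proj K V x)) =
    (TensorAlgebra.ι K ∘ₗ proj K V).rTensor (Unitization K V) (uComul K V x) := by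
  have h : coaction K V ∘ₗ TensorAlgebra.ι K ∘ₗ proj K V =
      (TensorAlgebra.ι K ∘ₗ proj K V).rTensor (Unitization K V) ∘ₗ uComul K V := by
    apply unitization_linear_ext
    · simp [uComul_one]
    · intro a
      simpa using coaction_ι' K a
  exact LinearMap.congr_fun h x

theorem coaction_rTensor_coaction_ι (a : V) :
    TensorProduct.assoc K _ _ _ ((coaction K V).rTensor (Unitization K V)
      (coaction K V (TensorAlgebra.ι K a))) =
    (uComul K V).lTensor (TensorAlgebra K V) (coaction K V (TensorAlgebra.ι K a)) := by
  have h1 : (coaction K V).rTensor (Unitization K V) ∘ₗ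
      (TensorAlgebra.ι K ∘ₗ proj K V).rTensor (Unitization K V) =
      ((TensorAlgebra.ι K ∘ₗ proj K V).rTensor (Unitization K V)).rTensor (Unitization K V) ∘ₗ
        (uComul K V).rTensor (Unitization K V) := by
    refine TensorProduct.ext' fun x y => ?_
    simp only [LinearMap.comp_apply, LinearMap.rTensor_tmul, coaction_ι_proj]
  have h2 : (TensorProduct.assoc K _ _ _).toLinearMap ∘ₗ
      ((TensorAlgebra.ι K ∘ₗ proj K V).rTensor (Unitization K V)).rTensor (Unitization K V) =
      (TensorAlgebra.ι K ∘ₗ proj K V).rTensor _ ∘ₗ (TensorProduct.assoc K _ _ _).toLinearMap :=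
    TensorProduct.ext_threefold fun x y z => by simp
  have h3 : (uComul K V).lTensor (TensorAlgebra K V) ∘ₗ
      (TensorAlgebra.ι K ∘ₗ proj K V).rTensor (Unitization K V) =
      (TensorAlgebra.ι K ∘ₗ proj K V).rTensor _ ∘ₗ (uComul K V).lTensor (Unitization K V) :=
    TensorProduct.ext' fun x y => by simp
  have h4 := Coalgebra.coassoc_apply (R := K) (Unitization.inr a : Unitization K V)
  rw [coaction_ι']
  refine ((congrArg _ (LinearMap.congr_fun h1 _)).trans (LinearMap.congr_fun h2 _)).trans
    (Eq.trans ?_ (LinearMap.congr_fun h3 _).symm)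
  exact congrArg _ h4

/-- Both sides are algebra morphisms for concatenation, so the letters decide. -/
theorem coaction_rTensor_coaction :
    (TensorProduct.assoc K _ _ _).toLinearMap ∘ₗ (coaction K V).rTensor (Unitization K V) ∘ₗ
      coaction K V = (uComul K V).lTensor (TensorAlgebra K V) ∘ₗ coaction K V := by
  have h : ((Algebra.TensorProduct.assoc K K K (TensorAlgebra K V) (Unitization K V)
        (Unitization K V)).toAlgHom.comp
      (Algebra.TensorProduct.map (coactionHom K V) (AlgHom.id K (Unitization K V)))).comp
        (coactionHom K V) =
      (Algebra.TensorProduct.map (AlgHom.id K (TensorAlgebra K V))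
        (Bialgebra.comulAlgHom K (Unitization K V))).comp (coactionHom K V) :=
    TensorAlgebra.hom_ext (LinearMap.ext fun a => coaction_rTensor_coaction_ι K a)
  exact congrArg AlgHom.toLinearMap h

theorem coaction_isRightCoaction :
    IsRightCoaction (BialgOps.ofBialgebra K (Unitization K V)) (coaction K V) where
  coassoc := coaction_rTensor_coaction K
  counit x := by
    have h : (Algebra.TensorProduct.map (AlgHom.id K (TensorAlgebra K V))
        (Bialgebra.counitAlgHom K (Unitization K V))).comp (coactionHom K V) =
        Algebra.TensorProduct.includeLeft := by
      refine TensorAlgebra.hom_ext (LinearMap.ext fun a => ?_)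
      have h3 : (uCounit K V).lTensor (TensorAlgebra K V) ∘ₗ
          (TensorAlgebra.ι K ∘ₗ proj K V).rTensor (Unitization K V) =
          (TensorAlgebra.ι K ∘ₗ proj K V).rTensor _ ∘ₗ (uCounit K V).lTensor (Unitization K V) :=
        TensorProduct.ext' fun x y => by simp
      have h4 := Coalgebra.lTensor_counit_comul (R := K) (Unitization.inr a : Unitization K V)
      have h5 : (uCounit K V).lTensor (TensorAlgebra K V) (coaction K V (TensorAlgebra.ι K a)) =
          TensorAlgebra.ι K a ⊗ₜ 1 := by
        rw [coaction_ι']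
        refine (LinearMap.congr_fun h3 _).trans
          ((congrArg ((TensorAlgebra.ι K ∘ₗ proj K V).rTensor K) h4).trans ?_)
        simp
      exact h5
    exact AlgHom.congr_fun h x

/-- Since ρ(ax) = ρ(a)ρ(x) with ρ(a) in the image of V ⊗ uV, both sides obey the recursion of
`qshA_ιA_mul`, available because uV is commutative. The contraction terms agree because δ_V is
multiplicative. -/
theorem coaction_qsh (hV : ∀ a b : V, a * b = b * a) (x y : TensorAlgebra K V) :
    coaction K V (qsh K V x y) =
      qshA K V (Unitization K V) (coaction K V x) (coaction K V y) := by
  have hU : ∀ a b : Unitization K V, a * b = b * a := fun a b => by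
    ext <;> simp [mul_comm, hV, add_comm]
  have hmul : ∀ a b : V, (incl K V).lTensor V (Coalgebra.comul (a * b)) =
      (incl K V).lTensor V (Coalgebra.comul a) * (incl K V).lTensor V (Coalgebra.comul b) :=
    fun a b => by
      rw [NonunitalBialgebra.comul_mul]
      exact lTensor_mul_of_map_mul K (f := incl K V) (fun a b => by simp) _ _
  have h : (qsh K V).compr₂ (coaction K V) =
      (qshA K V (Unitization K V)).compl₁₂ (coaction K V) (coaction K V) := by
    refine linearMap_ext_word fun k => linearMap_ext_word fun l => ?_
    simp only [LinearMap.compr₂_apply, LinearMap.compl₁₂_apply]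
    induction k generalizing l with
    | nil => rw [word_nil, one_qsh, coaction_one, one_qshA]
    | cons a k ihk =>
      induction l with
      | nil => rw [word_nil, qsh_one, coaction_one, qshA_one]
      | cons b l ihl =>
        have h1 := ihk (b :: l)
        simp only [word_cons, coaction_mul, coaction_ι] at *
        rw [qshA_ιA_mul K hU, qsh_ι_mul_ι_mul, map_add, map_add, coaction_mul, coaction_mul,
          coaction_mul, h1, ihl, ihk, coaction_ι, coaction_ι, coaction_ι, hmul]
  exact LinearMap.congr_fun (LinearMap.congr_fun h x) y

end Coaction

/-! ### Convolution of linear maps on T(V) and its fixed-point equations. -/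

section Convolution

variable (K : Type u) {V : Type v} [Field K] [NonUnitalRing V] [Module K V]
  {R : Type w} [Ring R] [Algebra K R]

/-- The convolution product of linear maps from `T(V)`, with deconcatenation, to an algebra. -/
def conv (f g : TensorAlgebra K V →ₗ[K] R) : TensorAlgebra K V →ₗ[K] R :=
  LinearMap.mul' K R ∘ₗ TensorProduct.map f g ∘ₗ deconc K V

variable (V R) in
/-- The unit of the convolution product. -/
def convUnit : TensorAlgebra K V →ₗ[K] R := Algebra.linearMap K R ∘ₗ deconcCounit K V

theorem convUnit_apply (x : TensorAlgebra K V) :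
    convUnit K V R x = algebraMap K R (deconcCounit K V x) := rfl

theorem conv_word (f g : TensorAlgebra K V →ₗ[K] R) (l : List V) :
    conv K f g (word K l) =
      ∑ i ∈ Finset.range (l.length + 1), f (word K (l.take i)) * g (word K (l.drop i)) := by
  simp [conv, deconc_word, deconcWord]

theorem conv_one (f g : TensorAlgebra K V →ₗ[K] R) : conv K f g 1 = f 1 * g 1 := by
  simp [conv, deconc_one]

theorem conv_word_cons (f g : TensorAlgebra K V →ₗ[K] R) (a : V) (l : List V) :
    conv K f g (word K (a :: l)) = ∑ i ∈ Finset.range (l.length + 1),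
      f (word K (a :: l.take i)) * g (word K (l.drop i)) + f 1 * g (word K (a :: l)) := by
  rw [conv_word, List.length_cons, Finset.sum_range_succ']
  simp

theorem add_conv (f g h : TensorAlgebra K V →ₗ[K] R) :
    conv K (f + g) h = conv K f h + conv K g h := by
  simp [conv, TensorProduct.map_add_left, LinearMap.add_comp, LinearMap.comp_add]

theorem convUnit_conv (f : TensorAlgebra K V →ₗ[K] R) : conv K (convUnit K V R) f = f := by
  ext x
  have h : LinearMap.mul' K R ∘ₗ TensorProduct.map (convUnit K V R) f =
      f ∘ₗ (TensorProduct.lid K _).toLinearMap ∘ₗ (deconcCounit K V).rTensor _ :=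
    TensorProduct.ext' fun x y => by
      simpa [convUnit_apply] using (Algebra.smul_def _ _).symm
  exact (LinearMap.congr_fun h (deconc K V x)).trans (by simp [deconcCounit_rTensor_deconc])

/-- Coassociativity of Δ combined with associativity of R. -/
theorem conv_assoc (f g h : TensorAlgebra K V →ₗ[K] R) :
    conv K (conv K f g) h = conv K f (conv K g h) := by
  have key : LinearMap.mul' K R ∘ₗ
      TensorProduct.map (LinearMap.mul' K R ∘ₗ TensorProduct.map f g) h =
      (LinearMap.mul' K R ∘ₗ
        TensorProduct.map f (LinearMap.mul' K R ∘ₗ TensorProduct.map g h)) ∘ₗ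
          (TensorProduct.assoc K _ _ _).toLinearMap :=
    TensorProduct.ext_threefold fun x y z => by simp [mul_assoc]
  have h1 : TensorProduct.map (conv K f g) h =
      TensorProduct.map (LinearMap.mul' K R ∘ₗ TensorProduct.map f g) h ∘ₗ
        (deconc K V).rTensor _ := TensorProduct.ext' fun x y => by simp [conv]
  have h2 : TensorProduct.map f (conv K g h) =
      TensorProduct.map f (LinearMap.mul' K R ∘ₗ TensorProduct.map g h) ∘ₗ
        (deconc K V).lTensor _ := TensorProduct.ext' fun x y => by simp [conv]
  change LinearMap.mul' K R ∘ₗ TensorProduct.map (conv K f g) h ∘ₗ deconc K V =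
    LinearMap.mul' K R ∘ₗ TensorProduct.map f (conv K g h) ∘ₗ deconc K V
  rw [h1, h2, LinearMap.comp_assoc, LinearMap.comp_assoc, ← deconc_coassoc]
  simpa only [LinearMap.comp_assoc] using
    congrArg (· ∘ₗ (deconc K V).rTensor _ ∘ₗ deconc K V) key

theorem algHom_comp_conv {R' : Type*} [Ring R'] [Algebra K R'] (j : R →ₐ[K] R')
    (f g : TensorAlgebra K V →ₗ[K] R) :
    j.toLinearMap ∘ₗ conv K f g = conv K (j.toLinearMap ∘ₗ f) (j.toLinearMap ∘ₗ g) :=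
  linearMap_ext_word fun l => by simp [conv_word]

theorem algHom_comp_convUnit {R' : Type*} [Ring R'] [Algebra K R'] (j : R →ₐ[K] R') :
    j.toLinearMap ∘ₗ convUnit K V R = convUnit K V R' := by
  ext x
  simp [convUnit_apply]

/-- The fixed-point equation `X = Y + f * X` has at most one solution if `f` vanishes on the empty
word. -/
theorem eq_of_eq_add_conv {f X X' Y : TensorAlgebra K V →ₗ[K] R} (hf : f 1 = 0)
    (h : X = Y + conv K f X) (h' : X' = Y + conv K f X') : X = X' := by
  refine linearMap_ext_word fun l => ?_
  induction hn : l.length using Nat.strong_induction_on generalizing l with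
  | _ n ih =>
    subst hn
    rw [h, h', LinearMap.add_apply, LinearMap.add_apply]
    cases l with
    | nil => simp [conv_one, hf]
    | cons a l =>
      -- The only term of f * X evaluating X on the whole word carries the factor f(1) = 0; every
      -- other term evaluates X on a strictly shorter suffix.
      rw [conv_word_cons, conv_word_cons, hf, zero_mul, zero_mul]
      congr 2
      refine Finset.sum_congr rfl fun i _ => ?_
      rw [ih _ (by simp) (l.drop i) rfl]

end Convolution

/-! ### Colinearity of deconcatenation, and T(V) as a bialgebra over V. -/

section Colinear

variable (K : Type u) {V : Type v} [Field K] [NonUnitalRing V] [Module K V]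

section

variable (V) (A : Type w) [Ring A] [Algebra K A]

/-- The map `t ⊗ a ↦ t ⊗ 1 ⊗ a`. -/
def insertRight : TensorAlgebra K V ⊗[K] A →ₐ[K] (TensorAlgebra K V ⊗[K] TensorAlgebra K V) ⊗[K] A :=
  Algebra.TensorProduct.map Algebra.TensorProduct.includeLeft (AlgHom.id K A)

/-- The map `t ⊗ a ↦ 1 ⊗ t ⊗ a`. -/
def insertLeft : TensorAlgebra K V ⊗[K] A →ₐ[K] (TensorAlgebra K V ⊗[K] TensorAlgebra K V) ⊗[K] A :=
  Algebra.TensorProduct.map Algebra.TensorProduct.includeRight (AlgHom.id K A)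

variable {V A}

theorem insertRight_mul_insertLeft (P Q : TensorAlgebra K V ⊗[K] A) :
    insertRight K V A P * insertLeft K V A Q =
      (LinearMap.mul' K A).lTensor (TensorAlgebra K V ⊗[K] TensorAlgebra K V)
        (TensorProduct.tensorTensorTensorComm K _ _ _ _ (P ⊗ₜ Q)) := by
  induction P using TensorProduct.induction_on with
  | zero => simp
  | add P P' h h' => simp only [TensorProduct.add_tmul, map_add, add_mul, h, h']
  | tmul a b =>
    induction Q using TensorProduct.induction_on with
    | zero => simp
    | add Q Q' h h' => simp only [TensorProduct.tmul_add, map_add, mul_add, h, h']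
    | tmul c d => simp [insertRight, insertLeft]

/-- The product of t ⊗ 1 ⊗ a and 1 ⊗ s ⊗ b is t ⊗ s ⊗ ab, which is m_{1,3,24}. This identifies the
comodule condition on Δ with the convolution form `DeconcColinear`. -/
theorem conv_insertRight_insertLeft (φ : TensorAlgebra K V →ₗ[K] TensorAlgebra K V ⊗[K] A) :
    conv K (R := (TensorAlgebra K V ⊗[K] TensorAlgebra K V) ⊗[K] A)
      ((insertRight K V A).toLinearMap ∘ₗ φ) ((insertLeft K V A).toLinearMap ∘ₗ φ) =
    ((LinearMap.mul' K A).lTensor (TensorAlgebra K V ⊗[K] TensorAlgebra K V) ∘ₗ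
      (TensorProduct.tensorTensorTensorComm K _ _ _ _).toLinearMap) ∘ₗ
        TensorProduct.map φ φ ∘ₗ deconc K V := by
  rw [conv, ← LinearMap.comp_assoc, ← LinearMap.comp_assoc]
  congr 1
  exact TensorProduct.ext' fun x y => insertRight_mul_insertLeft K (φ x) (φ y)

/-- Base change of `deconc_ι_mul`: either the cut precedes the leading letter, or that letter stays
at the head of the left factor. -/
theorem deconc_rTensor_ιA_mul (p : V ⊗[K] A) (Q : TensorAlgebra K V ⊗[K] A) :
    (deconc K V).rTensor A (ιA K V A p * Q) =
      insertLeft K V A (ιA K V A p * Q) +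
        insertRight K V A (ιA K V A p) * (deconc K V).rTensor A Q := by
  induction p using TensorProduct.induction_on with
  | zero => simp
  | add p p' h h' =>
    simp only [map_add, add_mul, h, h']
    abel
  | tmul v a =>
    induction Q using TensorProduct.induction_on with
    | zero => simp
    | add Q Q' h h' =>
      simp only [map_add, mul_add, h, h']
      abel
    | tmul t b =>
      simp [ιA, insertLeft, insertRight, deconc_ι_mul, TensorProduct.add_tmul]

/-- The coaction `φ` is compatible with deconcatenation. -/
def DeconcColinear (φ : TensorAlgebra K V →ₗ[K] TensorAlgebra K V ⊗[K] A) : Prop :=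
  (deconc K V).rTensor A ∘ₗ φ =
    conv K (R := (TensorAlgebra K V ⊗[K] TensorAlgebra K V) ⊗[K] A) ((insertRight K V A).toLinearMap ∘ₗ φ) ((insertLeft K V A).toLinearMap ∘ₗ φ)

variable {K} in
/-- Precomposition with a colinear coaction is compatible with the convolution product. -/
theorem DeconcColinear.conv_rTensor_comp {φ : TensorAlgebra K V →ₗ[K] TensorAlgebra K V ⊗[K] A}
    (hφ : DeconcColinear K φ) {R : Type*} [Ring R] [Algebra K R]
    (f g : TensorAlgebra K V →ₗ[K] R) :
    (conv K f g).rTensor A ∘ₗ φ = conv K (f.rTensor A ∘ₗ φ) (g.rTensor A ∘ₗ φ) := by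
  have h1 : (conv K f g).rTensor A ∘ₗ φ =
      (LinearMap.mul' K R ∘ₗ TensorProduct.map f g).rTensor A ∘ₗ (deconc K V).rTensor A ∘ₗ φ := by
    rw [← LinearMap.comp_assoc, ← LinearMap.rTensor_comp, LinearMap.comp_assoc]
    rfl
  have h2 : ∀ P Q : TensorAlgebra K V ⊗[K] A,
      (LinearMap.mul' K R ∘ₗ TensorProduct.map f g).rTensor A
        (insertRight K V A P * insertLeft K V A Q) = f.rTensor A P * g.rTensor A Q := by
    intro P Q
    induction P using TensorProduct.induction_on with
    | zero => simp
    | add P P' h h' => simp only [map_add, add_mul, h, h']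
    | tmul a b =>
      induction Q using TensorProduct.induction_on with
      | zero => simp
      | add Q Q' h h' => simp only [map_add, mul_add, h, h']
      | tmul c d => simp [insertRight, insertLeft]
  rw [DeconcColinear] at hφ
  rw [h1, hφ]
  refine linearMap_ext_word fun l => ?_
  simp [conv_word, h2]

end

variable [IsScalarTower K V V] [SMulCommClass K V V] [NonunitalBialgebra K V]

theorem coaction_deconcColinear : DeconcColinear K (coaction K V) := by
  rw [DeconcColinear]
  refine linearMap_ext_word
    (M := (TensorAlgebra K V ⊗[K] TensorAlgebra K V) ⊗[K] Unitization K V) fun l => ?_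
  induction l with
  | nil =>
    simp [conv_one, coaction_one, Algebra.TensorProduct.one_def, insertRight, insertLeft,
      deconc_one]
  | cons a l ih =>
    rw [LinearMap.comp_apply] at ih ⊢
    rw [word_cons, coaction_mul, coaction_ι, deconc_rTensor_ιA_mul, ih, ← coaction_ι,
      ← coaction_mul, ← word_cons, conv_word_cons, conv_word, Finset.mul_sum, add_comm]
    congr 1
    · exact Finset.sum_congr rfl fun i _ => by simp [coaction_mul, mul_assoc]
    · simp [coaction_one]

theorem coaction_counit_colinear (x : TensorAlgebra K V) :
    (deconcCounit K V).rTensor (Unitization K V) (coaction K V x) = deconcCounit K V x ⊗ₜ 1 := by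
  have h : (Algebra.TensorProduct.map TensorAlgebra.algebraMapInv
      (AlgHom.id K (Unitization K V))).comp (coactionHom K V) =
      (Algebra.TensorProduct.includeLeft).comp TensorAlgebra.algebraMapInv := by
    refine TensorAlgebra.hom_ext (LinearMap.ext fun a => ?_)
    have h1 : (deconcCounit K V).rTensor (Unitization K V)
        (coaction K V (TensorAlgebra.ι K a)) = 0 := by
      rw [coaction_ι, ιA]
      generalize (incl K V).lTensor V (Coalgebra.comul a) = P
      induction P using TensorProduct.induction_on with
      | zero => simp
      | add P P' h h' => simp only [map_add, h, h', add_zero]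
      | tmul a b => simp [deconcCounit, TensorAlgebra.algebraMapInv]
    refine Eq.trans h1 ?_
    simp [TensorAlgebra.algebraMapInv]
  exact AlgHom.congr_fun h x

/-- The augmentation `fst` is an algebra morphism with kernel V, so it detects the part of ρ(x)
lying outside T(V) ⊗ V. -/
theorem fst_lTensor_coaction (x : TensorAlgebra K V) :
    (Unitization.fstHom K V).toLinearMap.lTensor (TensorAlgebra K V) (coaction K V x) =
      1 ⊗ₜ deconcCounit K V x := by
  have h : (Algebra.TensorProduct.map (AlgHom.id K (TensorAlgebra K V))
      (Unitization.fstHom K V)).comp (coactionHom K V) =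
      (Algebra.TensorProduct.includeRight).comp TensorAlgebra.algebraMapInv := by
    refine TensorAlgebra.hom_ext (LinearMap.ext fun a => ?_)
    have h1 : (Unitization.fstHom K V).toLinearMap.lTensor (TensorAlgebra K V)
        (coaction K V (TensorAlgebra.ι K a)) = 0 := by
      rw [← coactionHom_apply, coactionHom, TensorAlgebra.lift_ι_apply, LinearMap.comp_apply]
      generalize (Coalgebra.comul a : V ⊗[K] V) = P
      induction P using TensorProduct.induction_on with
      | zero => simp
      | add P P' h h' => simp only [map_add, h, h', add_zero]
      | tmul a b => simp
    refine Eq.trans h1 ?_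
    simp [TensorAlgebra.algebraMapInv]
  exact AlgHom.congr_fun h x

/-- Right exactness of the tensor product, applied to V → uV → K: what is killed by id ⊗ `fst` comes
from T(V) ⊗ V. -/
theorem coaction_mem_range_of_deconcCounit_eq_zero {x : TensorAlgebra K V}
    (hx : deconcCounit K V x = 0) :
    coaction K V x ∈ LinearMap.range ((incl K V).lTensor (TensorAlgebra K V)) := by
  have h : Function.Exact (incl K V) (Unitization.fstHom K V).toLinearMap := by
    intro y
    constructor
    · intro hy
      exact ⟨y.snd, Unitization.ext (Eq.symm hy) rfl⟩
    · rintro ⟨v, rfl⟩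
      simp
  have h2 := lTensor_exact (TensorAlgebra K V) h
    (fun r => ⟨Unitization.inl r, Unitization.fst_inl V r⟩)
  exact (h2 _).1 (by rw [fst_lTensor_coaction, hx, TensorProduct.tmul_zero])

theorem qshOps_isBialgebraOverNonunital (hV : ∀ a b : V, a * b = b * a) :
    IsBialgebraOverNonunital V (qshOps K V) (coaction K V) where
  isBialgebraOver :=
    { isBialgebra := qshOps_isBialgebra K
      isRightCoaction := coaction_isRightCoaction K
      one_colinear := coaction_one K
      mul_colinear := TensorProduct.ext' fun x y =>
        (coaction_qsh K hV x y).trans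
          (map_lift_lift_tensorTensorTensorComm (qsh K V) (LinearMap.mul K (Unitization K V))
            (coaction K V x) (coaction K V y)).symm
      counit_colinear x := by
        refine (congrArg _ (coaction_counit_colinear K x)).trans ?_
        simp [qshOps, BialgOps.ofBialgebra]
      comul_colinear := by
        refine (coaction_deconcColinear K).trans ?_
        exact conv_insertRight_insertLeft K (coaction K V) }
  map_ker_le := by
    rintro _ ⟨x, hx, rfl⟩
    exact coaction_mem_range_of_deconcCounit_eq_zero K (V := V) hx

/-! ### Necessity of commutativity. -/

variable (V) in
/-- The algebra morphism `T(V) ⊗ A → A` induced by the counit of `V`. -/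
def counitA (A : Type w) [Ring A] [Algebra K A] : TensorAlgebra K V ⊗[K] A →ₐ[K] A :=
  (Algebra.TensorProduct.lid K A).toAlgHom.comp
    (Algebra.TensorProduct.map (TensorAlgebra.lift K (Coalgebra.counit (R := K) (A := V)))
      (AlgHom.id K A))

theorem counitA_tmul {A : Type w} [Ring A] [Algebra K A] (x : TensorAlgebra K V) (a : A) :
    counitA K V A (x ⊗ₜ a) =
      TensorAlgebra.lift K (Coalgebra.counit (R := K) (A := V)) x • a := by
  simp [counitA]

theorem counitA_coaction_ι (a : V) :
    counitA K V (Unitization K V) (coaction K V (TensorAlgebra.ι K a)) = Unitization.inr a := by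
  have h : (counitA K V (Unitization K V)).toLinearMap ∘ₗ
      TensorProduct.map (TensorAlgebra.ι K) (incl K V) =
      (incl K V) ∘ₗ (TensorProduct.lid K V).toLinearMap ∘ₗ
        (Coalgebra.counit (R := K) (A := V)).rTensor V :=
    TensorProduct.ext' fun x y => by simp [counitA_tmul]
  rw [← coactionHom_apply, coactionHom, TensorAlgebra.lift_ι_apply]
  refine (LinearMap.congr_fun h _).trans ?_
  simp

/-- The right factor is the same in the three terms of the quasishuffle of two letters. In the left
one ε_V forgets the order of letters and is multiplicative on the contraction, so the three terms
contribute equally. -/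
theorem counitA_qshA_ιA {A : Type w} [Ring A] [Algebra K A] (p q : V ⊗[K] A) :
    counitA K V A (qshA K V A (ιA K V A p) (ιA K V A q)) =
      counitA K V A (ιA K V A p) * counitA K V A (ιA K V A q) +
      counitA K V A (ιA K V A p) * counitA K V A (ιA K V A q) +
      counitA K V A (ιA K V A p) * counitA K V A (ιA K V A q) := by
  induction p using TensorProduct.induction_on with
  | zero => simp
  | add p p' h h' =>
    simp only [map_add, add_mul, LinearMap.add_apply, h, h']
    abel
  | tmul x a =>
    induction q using TensorProduct.induction_on with
    | zero => simp
    | add q q' h h' =>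
      simp only [map_add, mul_add, h, h']
      abel
    | tmul y b =>
      simp only [ιA, qshA, LinearMap.rTensor_tmul, TensorProduct.map₂_apply_tmul,
        TensorProduct.map_tmul, LinearMap.mul_apply', qsh_ι_ι, counitA_tmul, map_add, map_mul,
        TensorAlgebra.lift_ι_apply, NonunitalBialgebra.counit_mul, add_smul, smul_mul_smul_comm,
        mul_comm (Coalgebra.counit (R := K) y)]

/-- Under `counitA` the left side becomes a·b + b·a + a·b and the right side 3 a·b; cancelling
leaves b·a = a·b. -/
theorem mul_comm_of_coaction_qsh
    (h : ∀ a b : V, coaction K V (qsh K V (TensorAlgebra.ι K a) (TensorAlgebra.ι K b)) =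
      qshA K V (Unitization K V) (coaction K V (TensorAlgebra.ι K a))
        (coaction K V (TensorAlgebra.ι K b))) (a b : V) : a * b = b * a := by
  have h1 := congrArg (counitA K V (Unitization K V)) (h a b)
  rw [qsh_ι_ι, coaction_ι K a, coaction_ι K b, counitA_qshA_ιA, ← coaction_ι, ← coaction_ι] at h1
  simp only [map_add, coaction_mul, map_mul, counitA_coaction_ι, ← Unitization.inr_mul] at h1
  exact (Unitization.inr_injective (add_left_cancel (add_right_cancel h1))).symm

theorem IsBialgebraOverNonunital.mul_comm
    (h : IsBialgebraOverNonunital V (qshOps K V) (coaction K V)) (a b : V) : a * b = b * a :=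
  mul_comm_of_coaction_qsh K (fun a b =>
    (LinearMap.congr_fun h.isBialgebraOver.mul_colinear
      (TensorAlgebra.ι K a ⊗ₜ TensorAlgebra.ι K b)).trans
        (map_lift_lift_tensorTensorTensorComm (qsh K V) (LinearMap.mul K (Unitization K V))
          (coaction K V (TensorAlgebra.ι K a)) (coaction K V (TensorAlgebra.ι K b)))) a b

end Colinear

/-! ### The second coproduct as the solution of a fixed-point equation. -/

section Delta

variable (K : Type u) {V : Type v} [Field K] [NonUnitalRing V] [Module K V]

section

variable {A : Type w} [Ring A] [Algebra K A]

theorem deconcCounit_rTensor_ιA_mul (p : V ⊗[K] A) (Q : TensorAlgebra K V ⊗[K] A) :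
    (deconcCounit K V).rTensor A (ιA K V A p * Q) = 0 := by
  induction p using TensorProduct.induction_on with
  | zero => simp
  | add p p' h h' => simp only [map_add, add_mul, h, h', add_zero]
  | tmul v a =>
    induction Q using TensorProduct.induction_on with
    | zero => simp
    | add Q Q' h h' => simp only [map_add, mul_add, h, h', add_zero]
    | tmul t b => simp [ιA]

variable {K} in
theorem convUnit_rTensor_comp {φ : TensorAlgebra K V →ₗ[K] TensorAlgebra K V ⊗[K] A}
    (hφ : ∀ x, (deconcCounit K V).rTensor A (φ x) = deconcCounit K V x ⊗ₜ 1)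
    {R : Type*} [Ring R] [Algebra K R] :
    (convUnit K V R).rTensor A ∘ₗ φ = convUnit K V (R ⊗[K] A) := by
  ext x
  rw [convUnit, LinearMap.rTensor_comp, LinearMap.comp_assoc, LinearMap.comp_apply,
    LinearMap.comp_apply, hφ, LinearMap.rTensor_tmul, convUnit_apply]
  rfl

end

variable [IsScalarTower K V V] [SMulCommClass K V V]

/-- After passing to `QSh` the operation `concQsh` is the multiplication of an algebra, so the
recursion for δ becomes a convolution. -/
theorem lTensor_of_concQsh (P Q : TensorAlgebra K V ⊗[K] TensorAlgebra K V) :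
    (QSh.of K V).toLinearMap.lTensor _ (concQsh K V P Q) =
      (QSh.of K V).toLinearMap.lTensor _ P * (QSh.of K V).toLinearMap.lTensor _ Q := by
  induction P using TensorProduct.induction_on with
  | zero => simp
  | add P P' h h' => simp only [map_add, add_mul, LinearMap.add_apply, h, h']
  | tmul a b =>
    induction Q using TensorProduct.induction_on with
    | zero => simp
    | add Q Q' h h' => simp only [map_add, mul_add, h, h']
    | tmul c d => simp [concQsh, QSh.of_qsh]

variable [NonunitalBialgebra K V]

variable (V) in
/-- The map `v₁...vₙ ↦ v₁''·...·vₙ'' ⊗ v₁'...vₙ'` (and `1 ↦ 0`). -/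
def blockV : TensorAlgebra K V →ₗ[K] V ⊗[K] QSh K V :=
  TensorProduct.map (proj K V) (QSh.of K V).toLinearMap ∘ₗ
    (TensorProduct.comm K _ _).toLinearMap ∘ₗ coaction K V

theorem blockV_one : blockV K V 1 = 0 := by
  simp [blockV, coaction_one, Algebra.TensorProduct.one_def]

/-- The projection uV → V is not multiplicative, but it is on V, and ρ maps the kernel of ε_Δ into
T(V) ⊗ V. -/
theorem blockV_qsh (hV : ∀ a b : V, a * b = b * a) {x y : TensorAlgebra K V}
    (hx : deconcCounit K V x = 0) (hy : deconcCounit K V y = 0) :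
    blockV K V (qsh K V x y) = blockV K V x * blockV K V y := by
  obtain ⟨X, hX⟩ := coaction_mem_range_of_deconcCounit_eq_zero K hx
  obtain ⟨Y, hY⟩ := coaction_mem_range_of_deconcCounit_eq_zero K hy
  simp only [blockV, LinearMap.comp_apply, coaction_qsh K hV, ← hX, ← hY, LinearEquiv.coe_coe]
  clear hX hY
  induction X using TensorProduct.induction_on with
  | zero => simp
  | add P P' h h' => simp only [map_add, add_mul, LinearMap.add_apply, h, h']
  | tmul a b =>
    induction Y using TensorProduct.induction_on with
    | zero => simp
    | add Q Q' h h' => simp only [map_add, mul_add, h, h']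
    | tmul c d => simp [qshA, QSh.of_qsh]

variable (V) in
/-- The second coproduct, with the second tensor factor seen in the quasishuffle algebra. -/
def deltaQ : TensorAlgebra K V →ₗ[K] TensorAlgebra K V ⊗[K] QSh K V :=
  (QSh.of K V).toLinearMap.lTensor _ ∘ₗ delta K V

variable (V) in
/-- The map `v₁...vₙ ↦ (v₁'·...·vₙ') ⊗ v₁''...vₙ''` to `T(V) ⊗ QSh(V)`. -/
def blockQ : TensorAlgebra K V →ₗ[K] TensorAlgebra K V ⊗[K] QSh K V :=
  ιA K V (QSh K V) ∘ₗ blockV K V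

theorem blockQ_one : blockQ K V 1 = 0 := by
  simp [blockQ, blockV_one]

/-- Cocommutativity enters here: the block map multiplies the v' and keeps the v'' as a word,
whereas ρ does the opposite. Both are algebra morphisms, so letters suffice. -/
theorem lift_comul_eq_comm_coaction [Coalgebra.IsCocomm K V] (x : TensorAlgebra K V) :
    TensorAlgebra.lift K (TensorProduct.map (incl K V) (TensorAlgebra.ι K) ∘ₗ Coalgebra.comul) x =
      TensorProduct.comm K _ _ (coaction K V x) := by
  have h : TensorAlgebra.lift K
      (TensorProduct.map (incl K V) (TensorAlgebra.ι K) ∘ₗ Coalgebra.comul) =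
      (Algebra.TensorProduct.comm K (TensorAlgebra K V) (Unitization K V)).toAlgHom.comp
        (coactionHom K V) := by
    refine TensorAlgebra.hom_ext (LinearMap.ext fun a => ?_)
    rw [LinearMap.comp_apply, AlgHom.toLinearMap_apply, TensorAlgebra.lift_ι_apply,
      LinearMap.comp_apply, ← Coalgebra.comm_comul K a]
    simp only [LinearMap.comp_apply, AlgHom.toLinearMap_apply, AlgHom.comp_apply, coactionHom,
      TensorAlgebra.lift_ι_apply]
    generalize (Coalgebra.comul a : V ⊗[K] V) = P
    induction P using TensorProduct.induction_on with
    | zero => simp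
    | add P P' h h' => simp only [map_add, h, h']
    | tmul a b => simp
  exact AlgHom.congr_fun h x

theorem lTensor_of_block [Coalgebra.IsCocomm K V] (x : TensorAlgebra K V) :
    (QSh.of K V).toLinearMap.lTensor _ (block K V x) = blockQ K V x := by
  simp only [block, blockQ, blockV, LinearMap.comp_apply, AlgHom.toLinearMap_apply,
    lift_comul_eq_comm_coaction, LinearEquiv.coe_coe, ιA]
  generalize TensorProduct.comm K _ _ (coaction K V x) = P
  induction P using TensorProduct.induction_on with
  | zero => simp
  | add P P' h h' => simp only [map_add, h, h']
  | tmul a b => simp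

theorem delta_one : delta K V 1 = 1 ⊗ₜ 1 := by
  simpa [deltaWord] using delta_word K ([] : List V)

theorem deltaQ_one : deltaQ K V 1 = 1 := by
  simp [deltaQ, delta_one, QSh.of_one, Algebra.TensorProduct.one_def]

theorem deltaQ_word_cons [Coalgebra.IsCocomm K V] (a : V) (l : List V) :
    deltaQ K V (word K (a :: l)) = ∑ i ∈ Finset.range (l.length + 1),
      blockQ K V (word K (a :: l.take i)) * deltaQ K V (word K (l.drop i)) := by
  rw [deltaQ, LinearMap.comp_apply, delta_word, deltaWord, map_sum]
  refine Finset.sum_congr rfl fun i _ => ?_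
  rw [lTensor_of_concQsh, lTensor_of_block, LinearMap.comp_apply, delta_word]

/-- Δ cuts off the first block; the unit of convolution accounts for the empty word. -/
theorem deltaQ_eq [Coalgebra.IsCocomm K V] :
    deltaQ K V = convUnit K V _ + conv K (blockQ K V) (deltaQ K V) := by
  refine linearMap_ext_word (M := TensorAlgebra K V ⊗[K] QSh K V) fun l => ?_
  cases l with
  | nil => simp [conv_one, blockQ_one, deltaQ_one, convUnit_apply, Algebra.TensorProduct.one_def]
  | cons a l =>
    rw [LinearMap.add_apply, conv_word_cons, deltaQ_word_cons, convUnit_apply,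
      deconcCounit_word_cons, blockQ_one, map_zero, zero_mul, zero_add, add_zero]

theorem deltaQ_counit_colinear [Coalgebra.IsCocomm K V] (x : TensorAlgebra K V) :
    (deconcCounit K V).rTensor (QSh K V) (deltaQ K V x) = deconcCounit K V x ⊗ₜ 1 := by
  suffices h : (deconcCounit K V).rTensor (QSh K V) ∘ₗ deltaQ K V =
      (TensorProduct.mk K K (QSh K V)).flip 1 ∘ₗ deconcCounit K V from LinearMap.congr_fun h x
  refine linearMap_ext_word (M := K ⊗[K] QSh K V) fun l => ?_
  cases l with
  | nil => simp [deltaQ_one, Algebra.TensorProduct.one_def]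
  | cons a l =>
    rw [LinearMap.comp_apply, LinearMap.comp_apply, deltaQ_word_cons, map_sum,
      deconcCounit_word_cons, map_zero]
    exact Finset.sum_eq_zero fun i _ => deconcCounit_rTensor_ιA_mul K _ _

theorem algHom_comp_deltaQ [Coalgebra.IsCocomm K V] {R : Type*} [Ring R] [Algebra K R]
    (j : TensorAlgebra K V ⊗[K] QSh K V →ₐ[K] R) :
    j.toLinearMap ∘ₗ deltaQ K V = convUnit K V R +
      conv K (j.toLinearMap ∘ₗ blockQ K V) (j.toLinearMap ∘ₗ deltaQ K V) := by
  conv_lhs => rw [deltaQ_eq, LinearMap.comp_add, algHom_comp_conv, algHom_comp_convUnit]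

/-- Both sides solve X = Y + f * X with f and Y as given below. For the left side, each block
contributes a single leading letter to the first factor, so `deconc_rTensor_ιA_mul` applies. For the
right side, the equation of `deltaQ` is mapped by `insertRight` and convolved with Y. -/
theorem deltaQ_deconcColinear [Coalgebra.IsCocomm K V] : DeconcColinear K (deltaQ K V) := by
  rw [DeconcColinear]
  refine eq_of_eq_add_conv (R := (TensorAlgebra K V ⊗[K] TensorAlgebra K V) ⊗[K] QSh K V) K
    (f := (insertRight K V (QSh K V)).toLinearMap ∘ₗ blockQ K V)
    (Y := (insertLeft K V (QSh K V)).toLinearMap ∘ₗ deltaQ K V) (by simp [blockQ_one]) ?_ ?_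
  · refine linearMap_ext_word
      (M := (TensorAlgebra K V ⊗[K] TensorAlgebra K V) ⊗[K] QSh K V) fun l => ?_
    cases l with
    | nil =>
      simp [conv_one, blockQ_one, deltaQ_one, Algebra.TensorProduct.one_def, deconc_one,
        insertLeft]
    | cons a l =>
      rw [LinearMap.add_apply, conv_word_cons, LinearMap.comp_apply, LinearMap.comp_apply,
        LinearMap.comp_apply, deltaQ_word_cons, blockQ_one, map_zero, zero_mul, add_zero, map_sum,
        map_sum, ← Finset.sum_add_distrib]
      exact Finset.sum_congr rfl fun i _ => deconc_rTensor_ιA_mul K _ _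
  · have h := algHom_comp_deltaQ K
      (R := (TensorAlgebra K V ⊗[K] TensorAlgebra K V) ⊗[K] QSh K V) (insertRight K V (QSh K V))
    conv_lhs => rw [h]
    rw [add_conv, convUnit_conv, conv_assoc]

theorem deltaQ_rTensor_comp [Coalgebra.IsCocomm K V] {A : Type*} [Ring A] [Algebra K A]
    {φ : TensorAlgebra K V →ₗ[K] TensorAlgebra K V ⊗[K] A} (hφ : DeconcColinear K φ)
    (hφ' : ∀ x, (deconcCounit K V).rTensor A (φ x) = deconcCounit K V x ⊗ₜ 1) :
    (deltaQ K V).rTensor A ∘ₗ φ = convUnit K V ((TensorAlgebra K V ⊗[K] QSh K V) ⊗[K] A) +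
      conv K ((blockQ K V).rTensor A ∘ₗ φ) ((deltaQ K V).rTensor A ∘ₗ φ) := by
  conv_lhs => rw [deltaQ_eq, LinearMap.rTensor_add, LinearMap.add_comp, hφ.conv_rTensor_comp,
    convUnit_rTensor_comp hφ']

end Delta

/-! ### The second coproduct is multiplicative for the quasishuffle. -/

section DeltaMultiplicative

variable (K : Type u) {V : Type v} [Field K] [NonUnitalRing V] [Module K V]
  [IsScalarTower K V V] [SMulCommClass K V V] 

/-- The terms are sorted by which words contribute to the left factor: neither, the second, the
first, or both. The block map kills the case "neither"; the other three match the three terms of the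
quasishuffle recursion. -/
theorem deconc_qsh_word_cons (a b : V) (k l : List V) :
    deconc K V (qsh K V (word K (a :: k)) (word K (b :: l))) =
      1 ⊗ₜ qsh K V (word K (a :: k)) (word K (b :: l)) +
      ∑ j ∈ Finset.range (l.length + 1), word K (b :: l.take j) ⊗ₜ
        qsh K V (word K (a :: k)) (word K (l.drop j)) +
      ∑ i ∈ Finset.range (k.length + 1), (word K (a :: k.take i) ⊗ₜ
        qsh K V (word K (k.drop i)) (word K (b :: l)) +
        ∑ j ∈ Finset.range (l.length + 1),
          qsh K V (word K (a :: k.take i)) (word K (b :: l.take j)) ⊗ₜ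
            qsh K V (word K (k.drop i)) (word K (l.drop j))) := by
  have h : ∀ (a : V) (k : List V), deconc K V (word K (a :: k)) =
      1 ⊗ₜ word K (a :: k) + ∑ i ∈ Finset.range (k.length + 1),
        word K (a :: k.take i) ⊗ₜ word K (k.drop i) := by
    intro a k
    rw [deconc_word, deconcWord, List.length_cons, Finset.sum_range_succ', add_comm]
    rfl
  rw [deconc_qsh, h, h]
  simp only [map_add, map_sum, LinearMap.add_apply, LinearMap.sum_apply,
    TensorProduct.map₂_apply_tmul, TensorProduct.map_tmul, one_qsh, qsh_one,
    Finset.sum_add_distrib]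
  rw [Finset.sum_comm]
  abel

variable [NonunitalBialgebra K V] [Coalgebra.IsCocomm K V]

/-- The fixed-point equation is applied to the quasishuffle itself. In each term with a nonempty
left factor the right factors have smaller total length, so the induction hypothesis applies to
them, while `blockV_qsh` computes the block of a product. -/
theorem deltaQ_qsh_word (hV : ∀ a b : V, a * b = b * a) (k l : List V) :
    deltaQ K V (qsh K V (word K k) (word K l)) =
      qshA K V (QSh K V) (deltaQ K V (word K k)) (deltaQ K V (word K l)) := by
  induction hn : k.length + l.length using Nat.strong_induction_on generalizing k l with
  | _ n ih =>
    subst hn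
    match k, l with
    | [], l => rw [word_nil, one_qsh, deltaQ_one, one_qshA]
    | a :: k, [] => rw [word_nil, qsh_one, deltaQ_one, qshA_one]
    | a :: k, b :: l =>
      have ih' : ∀ k' l' : List V, k'.length + l'.length < k.length + l.length + 2 →
          deltaQ K V (qsh K V (word K k') (word K l')) =
            qshA K V (QSh K V) (deltaQ K V (word K k')) (deltaQ K V (word K l')) :=
        fun k' l' h => ih _ (by simp only [List.length_cons]; omega) k' l' rfl
      have h0 : deconcCounit K V (qsh K V (word K (a :: k)) (word K (b :: l))) = 0 := by
        rw [deconcCounit_qsh, deconcCounit_word_cons, zero_mul]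
      have hL : deltaQ K V (qsh K V (word K (a :: k)) (word K (b :: l))) =
          LinearMap.mul' K _ (TensorProduct.map (blockQ K V) (deltaQ K V)
            (deconc K V (qsh K V (word K (a :: k)) (word K (b :: l))))) := by
        conv_lhs => rw [deltaQ_eq, LinearMap.add_apply, convUnit_apply, h0, map_zero, zero_add]
        rfl
      have hb : ∀ i j, blockQ K V (qsh K V (word K (a :: k.take i)) (word K (b :: l.take j))) =
          ιA K V (QSh K V)
            (blockV K V (word K (a :: k.take i)) * blockV K V (word K (b :: l.take j))) :=
        fun i j => by
          rw [blockQ, LinearMap.comp_apply, blockV_qsh K hV (deconcCounit_word_cons K _ _)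
            (deconcCounit_word_cons K _ _)]
      have h1 : ∀ i, deltaQ K V (qsh K V (word K (k.drop i)) (word K (b :: l))) =
          qshA K V (QSh K V) (deltaQ K V (word K (k.drop i))) (deltaQ K V (word K (b :: l))) :=
        fun i => ih' _ _ (by simp; omega)
      have h2 : ∀ j, deltaQ K V (qsh K V (word K (a :: k)) (word K (l.drop j))) =
          qshA K V (QSh K V) (deltaQ K V (word K (a :: k))) (deltaQ K V (word K (l.drop j))) :=
        fun i => ih' _ _ (by simp; omega)
      have h3 : ∀ i j, deltaQ K V (qsh K V (word K (k.drop i)) (word K (l.drop j))) =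
          qshA K V (QSh K V) (deltaQ K V (word K (k.drop i))) (deltaQ K V (word K (l.drop j))) :=
        fun i j => ih' _ _ (by simp; omega)
      rw [hL, deconc_qsh_word_cons]
      simp only [map_add, map_sum, TensorProduct.map_tmul, LinearMap.mul'_apply, blockQ_one,
        zero_mul, zero_add, h1, h2, h3, hb]
      simp only [deltaQ_word_cons, map_sum, LinearMap.sum_apply, Finset.mul_sum]
      -- Blocks are letters with coefficients in QSh(V), which is commutative because V is; so the
      -- right side expands by the base-changed recursion.
      simp only [blockQ, LinearMap.comp_apply, qshA_ιA_mul K (QSh.mul_comm K hV)]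
      simp only [Finset.sum_add_distrib]
      rw [Finset.sum_comm]
      rw [← add_assoc, add_comm (∑ _ ∈ _, _)]
      -- The three families of terms now correspond; only the order of summation differs.
      exact congrArg₂ (· + ·) (congrArg₂ (· + ·) Finset.sum_comm rfl) Finset.sum_comm

theorem deltaQ_qsh (hV : ∀ a b : V, a * b = b * a) (x y : TensorAlgebra K V) :
    deltaQ K V (qsh K V x y) = qshA K V (QSh K V) (deltaQ K V x) (deltaQ K V y) := by
  have h : (qsh K V).compr₂ (deltaQ K V) =
      (qshA K V (QSh K V)).compl₁₂ (deltaQ K V) (deltaQ K V) :=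
    linearMap_ext_word fun k => linearMap_ext_word fun l => deltaQ_qsh_word K hV k l
  exact LinearMap.congr_fun (LinearMap.congr_fun h x) y

theorem delta_qsh (hV : ∀ a b : V, a * b = b * a) (x y : TensorAlgebra K V) :
    delta K V (qsh K V x y) =
      TensorProduct.map₂ (qsh K V) (qsh K V) (delta K V x) (delta K V y) := by
  refine lTensor_of_injective K ?_
  rw [lTensor_of_map₂_qsh_qsh]
  exact deltaQ_qsh K hV x y

end DeltaMultiplicative

/-! ### Compatibility of the second coproduct with ρ. -/

section Compatibility

variable (K : Type u) {V : Type v} [Field K] [NonUnitalRing V] [Module K V]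
  [IsScalarTower K V V] [SMulCommClass K V V]

variable (V) in
/-- The map `t ⊗ w ↦ w ⊗ t`, with `w` projected onto words of length one. -/
def swapProj : TensorAlgebra K V ⊗[K] Unitization K V →ₗ[K] TensorAlgebra K V ⊗[K] QSh K V :=
  ιA K V (QSh K V) ∘ₗ TensorProduct.map (proj K V) (QSh.of K V).toLinearMap ∘ₗ
    (TensorProduct.comm K _ _).toLinearMap

theorem swapProj_tmul (t : TensorAlgebra K V) (w : Unitization K V) :
    swapProj K V (t ⊗ₜ w) = TensorAlgebra.ι K (proj K V w) ⊗ₜ QSh.of K V t := by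
  simp [swapProj, ιA]

variable [NonunitalBialgebra K V]

theorem blockQ_eq_swapProj : blockQ K V = swapProj K V ∘ₗ coaction K V := rfl

variable (V) in
/-- The map `t ⊗ q ↦ (t' ⊗ q) ⊗ t''`, where `t' ⊗ t''` is the image of `t` by the coaction. -/
def coactionLeft : TensorAlgebra K V ⊗[K] QSh K V →ₐ[K]
    (TensorAlgebra K V ⊗[K] QSh K V) ⊗[K] Unitization K V :=
  (((Algebra.TensorProduct.assoc K K K (TensorAlgebra K V) (QSh K V)
      (Unitization K V)).symm.toAlgHom.comp
    (Algebra.TensorProduct.map (AlgHom.id K (TensorAlgebra K V))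
      (Algebra.TensorProduct.comm K (Unitization K V) (QSh K V)).toAlgHom)).comp
    (Algebra.TensorProduct.assoc K K K (TensorAlgebra K V) (Unitization K V)
      (QSh K V)).toAlgHom).comp
    (Algebra.TensorProduct.map (coactionHom K V) (AlgHom.id K (QSh K V)))

theorem coactionLeft_tmul (t : TensorAlgebra K V) (q : QSh K V) :
    coactionLeft K V (t ⊗ₜ q) = TensorProduct.rightComm K _ _ _ (coaction K V t ⊗ₜ q) := by
  rw [← coactionHom_apply]
  simp only [coactionLeft, AlgHom.comp_apply, Algebra.TensorProduct.map_tmul, AlgHom.id_apply]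
  generalize coactionHom K V t = P
  induction P using TensorProduct.induction_on with
  | zero => simp
  | add P P' h h' => simp only [TensorProduct.add_tmul, map_add, h, h']
  | tmul a b => rfl

theorem coactionLeft_swapProj (t : TensorAlgebra K V) (w : Unitization K V) :
    coactionLeft K V (swapProj K V (t ⊗ₜ w)) = (swapProj K V).rTensor (Unitization K V)
      ((TensorProduct.assoc K _ _ _).symm (t ⊗ₜ uComul K V w)) := by
  rw [swapProj_tmul, coactionLeft_tmul, coaction_ι_proj]
  generalize uComul K V w = P
  induction P using TensorProduct.induction_on with
  | zero => simp only [TensorProduct.zero_tmul, TensorProduct.tmul_zero, LinearEquiv.map_zero,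
      LinearMap.map_zero]
  | add P P' h h' => simp only [TensorProduct.add_tmul, TensorProduct.tmul_add, map_add, h, h']
  | tmul a b => simp [swapProj_tmul]

/-- This is coassociativity of ρ: applying ρ to the letter formed by a block amounts to applying the
coproduct of uV to the right factor of ρ. -/
theorem coactionLeft_comp_blockQ :
    (coactionLeft K V).toLinearMap ∘ₗ blockQ K V =
      (blockQ K V).rTensor (Unitization K V) ∘ₗ coaction K V := by
  have h1 : (coactionLeft K V).toLinearMap ∘ₗ swapProj K V =
      (swapProj K V).rTensor (Unitization K V) ∘ₗ
        (TensorProduct.assoc K _ _ _).symm.toLinearMap ∘ₗ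
          (uComul K V).lTensor (TensorAlgebra K V) :=
    TensorProduct.ext' fun t w => coactionLeft_swapProj K t w
  ext x
  have h2 := LinearMap.congr_fun h1 (coaction K V x)
  have h3 := LinearMap.congr_fun (coaction_rTensor_coaction K) x
  simp only [LinearMap.comp_apply, LinearEquiv.coe_coe] at h2 h3
  rw [← h3, LinearEquiv.symm_apply_apply] at h2
  rw [blockQ_eq_swapProj, LinearMap.rTensor_comp]
  exact h2

variable [Coalgebra.IsCocomm K V]

/-- Both sides solve X = 1 + f * X with the same f, by `coactionLeft_comp_blockQ`: on the left
because `coactionLeft` is an algebra morphism, on the right because ρ is Δ-colinear. -/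
theorem coactionLeft_comp_deltaQ :
    (coactionLeft K V).toLinearMap ∘ₗ deltaQ K V =
      (deltaQ K V).rTensor (Unitization K V) ∘ₗ coaction K V := by
  have h1 := algHom_comp_deltaQ K
    (R := (TensorAlgebra K V ⊗[K] QSh K V) ⊗[K] Unitization K V) (coactionLeft K V)
  have h2 := deltaQ_rTensor_comp K (coaction_deconcColinear K (V := V))
    (coaction_counit_colinear K)
  have h3 := coactionLeft_comp_blockQ K (V := V)
  refine eq_of_eq_add_conv (R := (TensorAlgebra K V ⊗[K] QSh K V) ⊗[K] Unitization K V) K ?_ h1 ?_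
  · simp [blockQ_one]
  · exact h2.trans (by rw [h3])

theorem delta_coaction_compat :
    (TensorProduct.rightComm K _ _ _).toLinearMap ∘ₗ (coaction K V).rTensor (TensorAlgebra K V) ∘ₗ
      delta K V = (delta K V).rTensor (Unitization K V) ∘ₗ coaction K V := by
  have hinj : Function.Injective
      (((QSh.of K V).toLinearMap.lTensor (TensorAlgebra K V)).rTensor (Unitization K V)) :=
    (LinearEquiv.rTensor (Unitization K V)
      (LinearEquiv.lTensor (TensorAlgebra K V) (QSh.of K V))).injective
  ext x
  apply hinj
  have h := LinearMap.congr_fun (coactionLeft_comp_deltaQ K (V := V)) x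
  have h1 : (((QSh.of K V).toLinearMap.lTensor (TensorAlgebra K V)).rTensor (Unitization K V)) ∘ₗ
      (TensorProduct.rightComm K _ _ _).toLinearMap ∘ₗ
        (coaction K V).rTensor (TensorAlgebra K V) =
      (coactionLeft K V).toLinearMap ∘ₗ (QSh.of K V).toLinearMap.lTensor (TensorAlgebra K V) := by
    refine TensorProduct.ext' fun t s => ?_
    simp only [LinearMap.comp_apply, LinearMap.rTensor_tmul, LinearMap.lTensor_tmul,
      AlgHom.toLinearMap_apply, LinearEquiv.coe_coe, coactionLeft_tmul]
    generalize coaction K V t = P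
    induction P using TensorProduct.induction_on with
    | zero => simp
    | add P P' h h' => simp only [TensorProduct.add_tmul, map_add, h, h']
    | tmul a b => simp
  refine (LinearMap.congr_fun h1 (delta K V x)).trans (h.trans ?_)
  rw [deltaQ, LinearMap.rTensor_comp]
  rfl

end Compatibility

/-! ### Counit and coassociativity of the second coproduct. -/

section DeltaCoalgebra

variable (K : Type u) {V : Type v} [Field K] [NonUnitalRing V] [Module K V]
  [IsScalarTower K V V] [SMulCommClass K V V]

theorem rTensor_of_qshA (P Q : TensorAlgebra K V ⊗[K] QSh K V) :
    (QSh.of K V).toLinearMap.rTensor (QSh K V) (qshA K V (QSh K V) P Q) =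
      (QSh.of K V).toLinearMap.rTensor (QSh K V) P *
        (QSh.of K V).toLinearMap.rTensor (QSh K V) Q := by
  induction P using TensorProduct.induction_on with
  | zero => simp
  | add P P' h h' => simp only [map_add, add_mul, LinearMap.add_apply, h, h']
  | tmul a b =>
    induction Q using TensorProduct.induction_on with
    | zero => simp
    | add Q Q' h h' => simp only [map_add, mul_add, h, h']
    | tmul c d => simp [qshA, QSh.of_qsh]

variable [NonunitalBialgebra K V]

theorem deltaCounit_one : deltaCounit K V 1 = 1 := by
  simpa [deltaCounitWord] using deltaCounit_word K ([] : List V)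

theorem deltaCounit_ι_mul (a : V) (x : TensorAlgebra K V) :
    deltaCounit K V (TensorAlgebra.ι K a * x) = Coalgebra.counit a * deconcCounit K V x := by
  have h : deltaCounit K V ∘ₗ LinearMap.mulLeft K (TensorAlgebra.ι K a) =
      (Coalgebra.counit (R := K) a) • deconcCounit K V := by
    refine linearMap_ext_word fun l => ?_
    have := deltaCounit_word K (a :: l)
    cases l <;> simpa [deltaCounitWord] using this
  exact LinearMap.congr_fun h x

/-- On ax ⧢ by, ε_δ applies ε_V to the first letter and ε_Δ to the rest. Since ε_Δ is multiplicative
and kills nonempty words, only the contraction term survives. -/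
theorem deltaCounit_qsh (x y : TensorAlgebra K V) :
    deltaCounit K V (qsh K V x y) = deltaCounit K V x * deltaCounit K V y := by
  have h : (qsh K V).compr₂ (deltaCounit K V) =
      (LinearMap.mul K K).compl₁₂ (deltaCounit K V) (deltaCounit K V) := by
    refine linearMap_ext_word fun k => linearMap_ext_word fun l => ?_
    cases k <;> cases l <;> simp [qsh_ι_mul_ι_mul, one_qsh, qsh_one, deltaCounit_one,
      deltaCounit_ι_mul, deconcCounit_qsh, NonunitalBialgebra.counit_mul, mul_mul_mul_comm]
  exact LinearMap.congr_fun (LinearMap.congr_fun h x) y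

variable (V) in
/-- The counit of `δ` as a character of the quasishuffle algebra. -/
def deltaCounitHom : QSh K V →ₐ[K] K :=
  AlgHom.ofLinearMap (deltaCounit K V ∘ₗ (QSh.of K V).symm.toLinearMap) (deltaCounit_one K)
    (deltaCounit_qsh K)

theorem deltaCounitHom_of (x : TensorAlgebra K V) :
    deltaCounitHom K V (QSh.of K V x) = deltaCounit K V x := rfl

theorem deltaCounit_rTensor_ιA_mul {A : Type*} [Ring A] [Algebra K A] (p : V ⊗[K] A)
    (Q : TensorAlgebra K V ⊗[K] A) :
    (deltaCounit K V).rTensor A (ιA K V A p * Q) =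
      (Coalgebra.counit (R := K) (A := V)).rTensor A p * (deconcCounit K V).rTensor A Q := by
  induction p using TensorProduct.induction_on with
  | zero => simp
  | add p p' h h' => simp only [map_add, add_mul, h, h']
  | tmul v a =>
    induction Q using TensorProduct.induction_on with
    | zero => simp
    | add Q Q' h h' => simp only [map_add, mul_add, h, h']
    | tmul t b => simp [ιA, deltaCounit_ι_mul]

theorem lTensor_deltaCounitHom_swapProj (P : TensorAlgebra K V ⊗[K] Unitization K V) :
    (deltaCounitHom K V).toLinearMap.lTensor (TensorAlgebra K V) (swapProj K V P) =
      (TensorAlgebra.ι K ∘ₗ proj K V).rTensor K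
        (TensorProduct.comm K _ _ ((deltaCounit K V).rTensor (Unitization K V) P)) := by
  induction P using TensorProduct.induction_on with
  | zero => simp
  | add P P' h h' => simp only [map_add, h, h']
  | tmul a b => simp [swapProj_tmul, deltaCounitHom_of]

/-- ε_δ kills words of length at least two, so only blocks of one letter survive. -/
theorem lTensor_deltaCounitHom_blockQ_word (a : V) (l : List V) :
    (deltaCounitHom K V).toLinearMap.lTensor (TensorAlgebra K V) (blockQ K V (word K (a :: l))) =
      deconcCounit K V (word K l) • (TensorAlgebra.ι K a ⊗ₜ 1) := by
  rw [blockQ_eq_swapProj, LinearMap.comp_apply, lTensor_deltaCounitHom_swapProj, word_cons,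
    coaction_mul, coaction_ι, deltaCounit_rTensor_ιA_mul, coaction_counit_colinear]
  have h : ∀ p : V ⊗[K] V, (Coalgebra.counit (R := K) (A := V)).rTensor (Unitization K V)
      ((incl K V).lTensor V p) =
        (incl K V).lTensor K ((Coalgebra.counit (R := K) (A := V)).rTensor V p) := by
    intro p
    induction p using TensorProduct.induction_on with
    | zero => simp
    | add P P' h h' => simp only [map_add, h, h']
    | tmul a b => simp
  rw [h, Coalgebra.rTensor_counit_comul]
  simp [TensorProduct.smul_tmul', TensorProduct.smul_tmul]

variable [Coalgebra.IsCocomm K V]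

theorem deltaCounitHom_lTensor_deltaQ (x : TensorAlgebra K V) :
    (deltaCounitHom K V).toLinearMap.lTensor (TensorAlgebra K V) (deltaQ K V x) = x ⊗ₜ 1 := by
  have h1 := algHom_comp_deltaQ K (V := V) (R := TensorAlgebra K V ⊗[K] K)
    (Algebra.TensorProduct.map (AlgHom.id K _) (deltaCounitHom K V))
  have h2 : (Algebra.TensorProduct.map (AlgHom.id K _) (deltaCounitHom K V)).toLinearMap ∘ₗ
      deltaQ K V = (Algebra.TensorProduct.includeLeft : _ →ₐ[K] TensorAlgebra K V ⊗[K] K) := by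
    refine eq_of_eq_add_conv (R := TensorAlgebra K V ⊗[K] K) K (by simp [blockQ_one]) h1 ?_
    refine linearMap_ext_word (M := TensorAlgebra K V ⊗[K] K) fun l => ?_
    have hb := lTensor_deltaCounitHom_blockQ_word K (V := V)
    cases l with
    | nil => simp [conv_one, blockQ_one, convUnit_apply]
    | cons a l =>
      -- The index i = 0 is the first block reduced to the letter a; longer first blocks vanish.
      rw [LinearMap.add_apply, conv_word_cons, convUnit_apply, deconcCounit_word_cons, map_zero,
        zero_add, LinearMap.comp_apply _ _ 1, blockQ_one, map_zero, zero_mul, add_zero, Finset.sum_eq_single 0]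
      · refine Eq.trans ?_ (congrArg (· * _) (hb a [])).symm
        simp
      · intro i hi hi0
        obtain ⟨j, rfl⟩ := Nat.exists_eq_succ_of_ne_zero hi0
        obtain ⟨b, l, rfl⟩ : ∃ b l', l = b :: l' := by
          cases l with
          | nil => simp at hi
          | cons b l => exact ⟨b, l, rfl⟩
        refine (congrArg (· * _) (hb a _)).trans ?_
        simp
      · simp
  exact LinearMap.congr_fun h2 x

-- The counit axiom of ρ, read on T(V) ⊗ V, where the counit of uV is ε_V.
omit [Coalgebra.IsCocomm K V] in
theorem counit_rTensor_blockV {x : TensorAlgebra K V} (hx : deconcCounit K V x = 0) :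
    (Coalgebra.counit (R := K) (A := V)).rTensor (QSh K V) (blockV K V x) =
      1 ⊗ₜ QSh.of K V x := by
  obtain ⟨X, hX⟩ := coaction_mem_range_of_deconcCounit_eq_zero K hx
  have h1 : (Coalgebra.counit (R := K) (A := V)).rTensor (QSh K V) ∘ₗ
      TensorProduct.map (proj K V) (QSh.of K V).toLinearMap ∘ₗ
        (TensorProduct.comm K _ _).toLinearMap ∘ₗ (incl K V).lTensor (TensorAlgebra K V) =
      (QSh.of K V).toLinearMap.lTensor K ∘ₗ (TensorProduct.comm K _ _).toLinearMap ∘ₗ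
        (uCounit K V).lTensor (TensorAlgebra K V) ∘ₗ (incl K V).lTensor (TensorAlgebra K V) :=
    TensorProduct.ext' fun a b => by simp [uCounit_inr]
  have h2 : (uCounit K V).lTensor (TensorAlgebra K V) (coaction K V x) = x ⊗ₜ 1 :=
    (coaction_isRightCoaction K).counit x
  have h3 := LinearMap.congr_fun h1 X
  simp only [LinearMap.comp_apply, hX, h2] at h3
  exact h3.trans (by simp)

theorem deltaCounit_rTensor_deltaQ (x : TensorAlgebra K V) :
    (deltaCounit K V).rTensor (QSh K V) (deltaQ K V x) = 1 ⊗ₜ QSh.of K V x := by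
  suffices h : (deltaCounit K V).rTensor (QSh K V) ∘ₗ deltaQ K V =
      TensorProduct.mk K K (QSh K V) 1 ∘ₗ (QSh.of K V).toLinearMap from LinearMap.congr_fun h x
  refine linearMap_ext_word (M := K ⊗[K] QSh K V) fun l => ?_
  cases l with
  | nil => simp [deltaQ_one, Algebra.TensorProduct.one_def, deltaCounit_one, QSh.of_one]
  | cons a l =>
    -- The left factor has one letter per block and ε_δ kills longer words, so only the cut into a
    -- single block remains.
    rw [LinearMap.comp_apply, deltaQ_word_cons, map_sum, Finset.sum_eq_single l.length]
    · rw [blockQ, LinearMap.comp_apply, deltaCounit_rTensor_ιA_mul, deltaQ_counit_colinear,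
        counit_rTensor_blockV K (deconcCounit_word_cons K _ _)]
      simp
    · intro i hi hi'
      obtain ⟨b, m, hm⟩ : ∃ b m, l.drop i = b :: m :=
        List.exists_cons_of_ne_nil (by simp at hi ⊢; omega)
      rw [blockQ, LinearMap.comp_apply, deltaCounit_rTensor_ιA_mul, deltaQ_counit_colinear, hm,
        deconcCounit_word_cons, TensorProduct.zero_tmul, mul_zero]
    · simp

variable (V) in
/-- The second coproduct as a morphism of quasishuffle algebras. -/
def deltaHom (hV : ∀ a b : V, a * b = b * a) : QSh K V →ₐ[K] QSh K V ⊗[K] QSh K V :=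
  AlgHom.ofLinearMap
    ((QSh.of K V).toLinearMap.rTensor (QSh K V) ∘ₗ deltaQ K V ∘ₗ (QSh.of K V).symm.toLinearMap)
    (by
      change (QSh.of K V).toLinearMap.rTensor (QSh K V) (deltaQ K V 1) = 1
      rw [deltaQ_one]
      rfl)
    (fun x y => (congrArg _ (deltaQ_qsh K hV x y)).trans (rTensor_of_qshA K _ _))

variable (V) in
/-- The map `id ⊗ δ`, with values in `(T(V) ⊗ QSh(V)) ⊗ QSh(V)`. -/
def deltaRight (hV : ∀ a b : V, a * b = b * a) : TensorAlgebra K V ⊗[K] QSh K V →ₐ[K]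
    (TensorAlgebra K V ⊗[K] QSh K V) ⊗[K] QSh K V :=
  (Algebra.TensorProduct.assoc K K K (TensorAlgebra K V) (QSh K V) (QSh K V)).symm.toAlgHom.comp
    (Algebra.TensorProduct.map (AlgHom.id K (TensorAlgebra K V)) (deltaHom K V hV))

theorem deltaRight_tmul (hV : ∀ a b : V, a * b = b * a) (s t : TensorAlgebra K V) :
    deltaRight K V hV (s ⊗ₜ QSh.of K V t) = (TensorProduct.assoc K _ _ _).symm
      (s ⊗ₜ (QSh.of K V).toLinearMap.rTensor (QSh K V) (deltaQ K V t)) := rfl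

/-- A block is a flipped value of ρ, so applying δ to its word part means computing (δ ⊗ id) ∘ ρ,
which the compatibility `coactionLeft_comp_deltaQ` rewrites with ρ applied after δ. -/
theorem deltaRight_comp_blockQ (hV : ∀ a b : V, a * b = b * a) :
    (deltaRight K V hV).toLinearMap ∘ₗ blockQ K V =
      (blockQ K V).rTensor (QSh K V) ∘ₗ deltaQ K V := by
  have h1 : (deltaRight K V hV).toLinearMap ∘ₗ swapProj K V =
      (swapProj K V).rTensor (QSh K V) ∘ₗ (TensorProduct.rightComm K _ _ _).toLinearMap ∘ₗ
        (deltaQ K V).rTensor (Unitization K V) := by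
    refine TensorProduct.ext' fun t w => ?_
    simp only [LinearMap.comp_apply, AlgHom.toLinearMap_apply, swapProj_tmul, deltaRight_tmul,
      LinearMap.rTensor_tmul, LinearEquiv.coe_coe]
    generalize deltaQ K V t = P
    induction P using TensorProduct.induction_on with
    | zero => simp only [TensorProduct.zero_tmul, TensorProduct.tmul_zero, LinearEquiv.map_zero,
        LinearMap.map_zero]
    | add P P' h h' => simp only [TensorProduct.add_tmul, TensorProduct.tmul_add, map_add, h, h']
    | tmul a b => simp [swapProj_tmul]
  have h2 : (blockQ K V).rTensor (QSh K V) = (swapProj K V).rTensor (QSh K V) ∘ₗ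
      (TensorProduct.rightComm K _ _ _).toLinearMap ∘ₗ (coactionLeft K V).toLinearMap := by
    refine TensorProduct.ext' fun t q => ?_
    simp only [LinearMap.comp_apply, AlgHom.toLinearMap_apply, coactionLeft_tmul,
      LinearMap.rTensor_tmul, LinearEquiv.coe_coe, blockQ_eq_swapProj]
    generalize coaction K V t = P
    induction P using TensorProduct.induction_on with
    | zero => simp only [TensorProduct.zero_tmul, LinearEquiv.map_zero, LinearMap.map_zero]
    | add P P' h h' => simp only [TensorProduct.add_tmul, map_add, h, h']
    | tmul a b => simp
  rw [h2, LinearMap.comp_assoc, LinearMap.comp_assoc, coactionLeft_comp_deltaQ,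
    blockQ_eq_swapProj, ← LinearMap.comp_assoc, h1]
  rfl

/-- Again two solutions of one equation: δ is itself a Δ-colinear coaction for the left side, and
`deltaRight` is an algebra morphism, by multiplicativity of δ, for the right side. -/
theorem deltaRight_comp_deltaQ (hV : ∀ a b : V, a * b = b * a) :
    (deltaQ K V).rTensor (QSh K V) ∘ₗ deltaQ K V =
      (deltaRight K V hV).toLinearMap ∘ₗ deltaQ K V := by
  have h1 := algHom_comp_deltaQ K
    (R := (TensorAlgebra K V ⊗[K] QSh K V) ⊗[K] QSh K V) (deltaRight K V hV)
  have h2 := deltaQ_rTensor_comp K (deltaQ_deconcColinear K (V := V))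
    (deltaQ_counit_colinear K)
  have h3 := deltaRight_comp_blockQ K hV
  refine (eq_of_eq_add_conv (R := (TensorAlgebra K V ⊗[K] QSh K V) ⊗[K] QSh K V) K ?_ h1 ?_).symm
  · simp [blockQ_one]
  · exact h2.trans (by rw [h3])

end DeltaCoalgebra

/-! ### The double bialgebra structure on T(V). -/

section DoubleBialgebra

variable (K : Type u) {V : Type v} [Field K] [NonUnitalRing V] [Module K V]
  [IsScalarTower K V V] [SMulCommClass K V V] [NonunitalBialgebra K V]

section

variable [Coalgebra.IsCocomm K V]

/-- Transport of `deltaRight_comp_deltaQ` along the identification of QSh(V) with T(V). -/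
theorem delta_coassoc (hV : ∀ a b : V, a * b = b * a) :
    (TensorProduct.assoc K _ _ _).toLinearMap ∘ₗ
      (delta K V).rTensor (TensorAlgebra K V) ∘ₗ delta K V =
    (delta K V).lTensor (TensorAlgebra K V) ∘ₗ delta K V := by
  have hinj : Function.Injective (TensorProduct.map
      ((QSh.of K V).toLinearMap.lTensor (TensorAlgebra K V)) (QSh.of K V).toLinearMap) :=
    (TensorProduct.congr (LinearEquiv.lTensor (TensorAlgebra K V) (QSh.of K V))
      (QSh.of K V)).injective
  have h1 : TensorProduct.map ((QSh.of K V).toLinearMap.lTensor (TensorAlgebra K V))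
      (QSh.of K V).toLinearMap ∘ₗ (delta K V).rTensor (TensorAlgebra K V) =
      (deltaQ K V).rTensor (QSh K V) ∘ₗ (QSh.of K V).toLinearMap.lTensor (TensorAlgebra K V) :=
    TensorProduct.ext' fun s t => by simp [deltaQ]
  have h2 : TensorProduct.map ((QSh.of K V).toLinearMap.lTensor (TensorAlgebra K V))
      (QSh.of K V).toLinearMap ∘ₗ (TensorProduct.assoc K _ _ _).symm.toLinearMap ∘ₗ
        (delta K V).lTensor (TensorAlgebra K V) =
      (deltaRight K V hV).toLinearMap ∘ₗ
        (QSh.of K V).toLinearMap.lTensor (TensorAlgebra K V) := by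
    refine TensorProduct.ext' fun s t => ?_
    simp only [LinearMap.comp_apply, LinearMap.lTensor_tmul, AlgHom.toLinearMap_apply,
      LinearEquiv.coe_coe, deltaRight_tmul, deltaQ]
    generalize delta K V t = P
    induction P using TensorProduct.induction_on with
    | zero => simp only [TensorProduct.tmul_zero, LinearEquiv.map_zero, LinearMap.map_zero]
    | add P P' h h' => simp only [TensorProduct.tmul_add, map_add, h, h']
    | tmul a b => simp
  ext x
  apply (TensorProduct.assoc K (TensorAlgebra K V) (TensorAlgebra K V)
    (TensorAlgebra K V)).symm.injective
  apply hinj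
  simp only [LinearMap.comp_apply, LinearEquiv.coe_coe, LinearEquiv.symm_apply_apply]
  refine (LinearMap.congr_fun h1 (delta K V x)).trans
    (Eq.trans ?_ (LinearMap.congr_fun h2 (delta K V x)).symm)
  exact LinearMap.congr_fun (deltaRight_comp_deltaQ K hV) x

theorem delta_counit_left (x : TensorAlgebra K V) :
    (deltaCounit K V).rTensor (TensorAlgebra K V) (delta K V x) = 1 ⊗ₜ x := by
  refine lTensor_of_injective K ?_
  rw [LinearMap.lTensor_tmul, LinearEquiv.coe_coe, ← deltaCounit_rTensor_deltaQ, deltaQ,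
    LinearMap.comp_apply, lTensor_rTensor_apply]

theorem delta_counit_right (x : TensorAlgebra K V) :
    (deltaCounit K V).lTensor (TensorAlgebra K V) (delta K V x) = x ⊗ₜ 1 := by
  rw [← deltaCounitHom_lTensor_deltaQ, deltaQ, LinearMap.comp_apply,
    ← LinearMap.comp_apply (LinearMap.lTensor _ _) (LinearMap.lTensor _ _),
    ← LinearMap.lTensor_comp]
  rfl

theorem delta_isBialgebra (hV : ∀ a b : V, a * b = b * a) :
    BialgOps.IsBialgebra (K := K)
      ⟨(qshOps K V).mul, (qshOps K V).one, delta K V, deltaCounit K V⟩ where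
  mul_assoc := (qshOps_isBialgebra K).mul_assoc
  one_mul := (qshOps_isBialgebra K).one_mul
  mul_one := (qshOps_isBialgebra K).mul_one
  coassoc := delta_coassoc K hV
  counit_left := delta_counit_left K
  counit_right := delta_counit_right K
  comul_one := delta_one K
  counit_one := deltaCounit_one K
  comul_mul := TensorProduct.ext' fun x y => by
    simp [qshOps, map_lift_lift_tensorTensorTensorComm, delta_qsh K hV]
  counit_mul x y := by simpa [qshOps] using deltaCounit_qsh K x y

theorem delta_counit_colinear (x : TensorAlgebra K V) :
    (deconcCounit K V).rTensor (TensorAlgebra K V) (delta K V x) = deconcCounit K V x ⊗ₜ 1 := by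
  refine lTensor_of_injective K ?_
  rw [LinearMap.lTensor_tmul, LinearEquiv.coe_coe, QSh.of_one, ← deltaQ_counit_colinear, deltaQ,
    LinearMap.comp_apply, lTensor_rTensor_apply]

theorem delta_comul_colinear :
    (deconc K V).rTensor (TensorAlgebra K V) ∘ₗ delta K V =
      mul13_24 (K := K) (TensorAlgebra K V)
        ⟨(qshOps K V).mul, (qshOps K V).one, delta K V, deltaCounit K V⟩ ∘ₗ
        TensorProduct.map (delta K V) (delta K V) ∘ₗ deconc K V := by
  have h := deltaQ_deconcColinear K (V := V)
  rw [DeconcColinear, conv_insertRight_insertLeft] at h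
  have h1 : ((LinearMap.mul' K (QSh K V)).lTensor (TensorAlgebra K V ⊗[K] TensorAlgebra K V) ∘ₗ
      (TensorProduct.tensorTensorTensorComm K _ _ _ _).toLinearMap) ∘ₗ
        TensorProduct.map ((QSh.of K V).toLinearMap.lTensor (TensorAlgebra K V))
          ((QSh.of K V).toLinearMap.lTensor (TensorAlgebra K V)) =
      (QSh.of K V).toLinearMap.lTensor (TensorAlgebra K V ⊗[K] TensorAlgebra K V) ∘ₗ
        mul13_24 (K := K) (TensorAlgebra K V)
          ⟨(qshOps K V).mul, (qshOps K V).one, delta K V, deltaCounit K V⟩ :=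
    TensorProduct.ext_fourfold' fun a b c d => by simp [mul13_24, qshOps, QSh.of_qsh]
  ext x
  refine lTensor_of_injective K ?_
  have h2 := LinearMap.congr_fun h x
  have h3 := LinearMap.congr_fun h1 (TensorProduct.map (delta K V) (delta K V) (deconc K V x))
  simp only [LinearMap.comp_apply] at h3 ⊢
  rw [← h3]
  simp only [deltaQ, TensorProduct.map_comp, LinearMap.comp_apply] at h2
  rw [← h2, lTensor_rTensor_apply]

theorem qshOps_isDoubleBialgebra (hV : ∀ a b : V, a * b = b * a) :
    IsDoubleBialgebra (qshOps K V) (delta K V) (deltaCounit K V) where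
  isBialgebra := delta_isBialgebra K hV
  isBialgebraOver :=
    { isBialgebra := qshOps_isBialgebra K
      isRightCoaction := ⟨delta_coassoc K hV, delta_counit_right K⟩
      one_colinear := delta_one K
      mul_colinear := (delta_isBialgebra K hV).comul_mul
      counit_colinear x := by
        refine (congrArg _ (delta_counit_colinear K x)).trans ?_
        simp [qshOps]
      comul_colinear := delta_comul_colinear K }

theorem qshOps_isDoubleBialgebraOverNonunital (hV : ∀ a b : V, a * b = b * a) :
    IsDoubleBialgebraOverNonunital V (qshOps K V) (delta K V) (deltaCounit K V)
      (coaction K V) where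
  isDoubleBialgebraOver :=
    { isDoubleBialgebra := qshOps_isDoubleBialgebra K hV
      isBialgebraOver := (qshOps_isBialgebraOverNonunital K hV).isBialgebraOver
      compat := delta_coaction_compat K }
  isBialgebraOverNonunital := qshOps_isBialgebraOverNonunital K hV

end

/-! ### Necessity of cocommutativity. -/

theorem delta_ι (a : V) : delta K V (TensorAlgebra.ι K a) =
    TensorProduct.map (TensorAlgebra.ι K) (TensorAlgebra.ι K) (Coalgebra.comul a) := by
  have h := delta_word K [a]
  have h1 : ∀ P : TensorAlgebra K V ⊗[K] TensorAlgebra K V, concQsh K V P ((1 : TensorAlgebra K V) ⊗ₜ (1 : TensorAlgebra K V)) = P := by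
    intro P
    induction P using TensorProduct.induction_on with
    | zero => simp
    | add P P' h h' => simp only [map_add, LinearMap.add_apply, h, h']
    | tmul a b => simp [concQsh, qsh_one]
  have h2 : TensorProduct.map (TensorAlgebra.ι K ∘ₗ proj K V) LinearMap.id ∘ₗ
      TensorProduct.map (incl K V) (TensorAlgebra.ι K (M := V)) =
      TensorProduct.map (TensorAlgebra.ι K) (TensorAlgebra.ι K) :=
    TensorProduct.ext' fun a b => by simp
  have h3 := LinearMap.congr_fun h2 (Coalgebra.comul a)
  simp only [deltaWord, word_cons, word_nil, mul_one, h1, List.length_nil, zero_add,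
    Finset.range_one, Finset.sum_singleton, List.take_zero, List.drop_zero, block,
    LinearMap.comp_apply, AlgHom.toLinearMap_apply, TensorAlgebra.lift_ι_apply] at h h3
  exact h.trans h3

variable (V) in
/-- The map `T(V) ⊗ T(V) ⊗ uV → V ⊗ V` which applies the counit of `V` to the letters of the first
factor, and projects the other factors onto `V`. -/
def counitProj : (TensorAlgebra K V ⊗[K] TensorAlgebra K V) ⊗[K] Unitization K V →ₗ[K] V ⊗[K] V :=
  TensorProduct.map ((TensorProduct.lid K V).toLinearMap ∘ₗ
    TensorProduct.map (TensorAlgebra.lift K (Coalgebra.counit (R := K) (A := V))).toLinearMap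
      (proj K V ∘ₗ (TensorAlgebra.lift K (incl K V)).toLinearMap)) (proj K V)

theorem counitProj_tmul_ι (s : TensorAlgebra K V) (b : V) (w : Unitization K V) :
    counitProj K V ((s ⊗ₜ TensorAlgebra.ι K b) ⊗ₜ w) =
      TensorAlgebra.lift K (Coalgebra.counit (R := K) (A := V)) s • (b ⊗ₜ proj K V w) := by
  simp [counitProj, TensorProduct.smul_tmul']

/-- On a letter the hypothesis compares a' ⊗ a''' ⊗ a'' with a' ⊗ a'' ⊗ a'''. Applying ε_V to the
first factor turns the two sides into the flip of δ_V(a) (`h1`) and δ_V(a) itself (`h4`). -/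
theorem isCocomm_of_delta_coaction_compat
    (h : (TensorProduct.rightComm K _ _ _).toLinearMap ∘ₗ
      (coaction K V).rTensor (TensorAlgebra K V) ∘ₗ delta K V =
        (delta K V).rTensor (Unitization K V) ∘ₗ coaction K V) : Coalgebra.IsCocomm K V := by
  have h1 : counitProj K V ∘ₗ (TensorProduct.rightComm K _ _ _).toLinearMap ∘ₗ
      (coaction K V).rTensor (TensorAlgebra K V) ∘ₗ
        TensorProduct.map (TensorAlgebra.ι K) (TensorAlgebra.ι K) =
      (TensorProduct.comm K V V).toLinearMap := by
    refine TensorProduct.ext' fun a b => ?_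
    have h2 : ∀ P : V ⊗[K] V, counitProj K V (TensorProduct.rightComm K _ _ _
        (TensorProduct.map (TensorAlgebra.ι K) (incl K V) P ⊗ₜ TensorAlgebra.ι K b)) =
        b ⊗ₜ TensorProduct.lid K V ((Coalgebra.counit (R := K) (A := V)).rTensor V P) := by
      intro P
      induction P using TensorProduct.induction_on with
      | zero => simp
      | add P P' h h' => simp only [TensorProduct.add_tmul, TensorProduct.tmul_add, map_add, h, h']
      | tmul a c => simp [counitProj_tmul_ι]
    have h3 := h2 (Coalgebra.comul a)
    rw [Coalgebra.rTensor_counit_comul] at h3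
    simpa [← coactionHom_apply, coactionHom, TensorAlgebra.lift_ι_apply] using h3
  have h4 : counitProj K V ∘ₗ (delta K V).rTensor (Unitization K V) ∘ₗ
      TensorProduct.map (TensorAlgebra.ι K) (incl K V) = LinearMap.id := by
    refine TensorProduct.ext' fun a b => ?_
    have h2 : ∀ P : V ⊗[K] V, counitProj K V
        (TensorProduct.map (TensorAlgebra.ι K) (TensorAlgebra.ι K) P ⊗ₜ
          (Unitization.inr b : Unitization K V)) =
        TensorProduct.lid K V ((Coalgebra.counit (R := K) (A := V)).rTensor V P) ⊗ₜ b := by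
      intro P
      induction P using TensorProduct.induction_on with
      | zero => simp
      | add P P' h h' => simp only [TensorProduct.add_tmul, map_add, h, h']
      | tmul a c => simp [counitProj_tmul_ι, TensorProduct.smul_tmul']
    have h3 := h2 (Coalgebra.comul a)
    rw [Coalgebra.rTensor_counit_comul] at h3
    simpa [delta_ι] using h3
  refine ⟨LinearMap.ext fun a => ?_⟩
  have h5 := congrArg (counitProj K V) (LinearMap.congr_fun h (TensorAlgebra.ι K a))
  have h6 := LinearMap.congr_fun h1 (Coalgebra.comul a)
  have h7 := LinearMap.congr_fun h4 (Coalgebra.comul a)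
  have h8 : coaction K V (TensorAlgebra.ι K a) =
      TensorProduct.map (TensorAlgebra.ι K) (incl K V) (Coalgebra.comul a) :=
    TensorAlgebra.lift_ι_apply ..
  simp only [LinearMap.comp_apply, delta_ι, h8] at h5 h6 h7
  exact h6.symm.trans (h5.trans h7)

end DoubleBialgebra

end QuasiShuffle

end

theorem mainTheorem5 (K : Type*) (V : Type*) [Field K] [CharZero K] [NonUnitalRing V] [Module K V]
    [IsScalarTower K V V] [SMulCommClass K V V] [QuasiShuffle.NonunitalBialgebra K V] :
    QuasiShuffle.IsRightCoaction (QuasiShuffle.BialgOps.ofBialgebra K (Unitization K V))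
        (QuasiShuffle.coaction K V) ∧
      (QuasiShuffle.IsBialgebraOverNonunital V (QuasiShuffle.qshOps K V)
          (QuasiShuffle.coaction K V) ↔
        ∀ a b : V, a * b = b * a) ∧
      (QuasiShuffle.IsDoubleBialgebraOverNonunital V (QuasiShuffle.qshOps K V)
          (QuasiShuffle.delta K V) (QuasiShuffle.deltaCounit K V) (QuasiShuffle.coaction K V) ↔
        (∀ a b : V, a * b = b * a) ∧ Coalgebra.IsCocomm K V) :=
  ⟨QuasiShuffle.coaction_isRightCoaction K,
    ⟨QuasiShuffle.IsBialgebraOverNonunital.mul_comm K,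
      QuasiShuffle.qshOps_isBialgebraOverNonunital K⟩,
    ⟨fun h => ⟨h.isBialgebraOverNonunital.mul_comm K,
        QuasiShuffle.isCocomm_of_delta_coaction_compat K h.isDoubleBialgebraOver.compat⟩,
      fun h => by
        have := h.2
        exact QuasiShuffle.qshOps_isDoubleBialgebraOverNonunital K h.1⟩⟩
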